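/- **Setting.** Equip $\mathbb R^{2n}=\mathbb R^n_x\times\mathbb R^n_p$ with the symplectic form $\sigma=dp\wedge dx$, let $\hbar>0$ and $h=2\pi\hbar$. A *symplectomorphism* is a $C^\infty$ diffeomorphism between open subsets of $\mathbb R^{2n}$ whose differential preserves $\sigma$ at every point. A *symplectic capacity* assigns to every $\Omega\subset\mathbb R^{2n}$ a number $c(\Omega)\in[0,\infty]$ such that: $c(\Omega)\le c(\Omega')$ if $\Omega\subset\Omega'$; $c(\lambda\Omega)=\lambda^2c(\Omega)$ for $\lambda\in\mathbb R$; $c(g(\Omega))=c(\Omega)$ for every symplectomorphism $g$ of $\mathbb R^{2n}$ onto itself; and $c(\{|z|\le R\})=\pi R^2=c(\{x_j^2+p_j^2\le R^2\})$ for all $R>0$ and $1\le j\le n$. Let $H\in C^\infty(\mathbb R^{2n},\mathbb R)$ and let $f$ be a symplectomorphism (not necessarily globally defined) from an open set $W\subset\mathbb R^{2n}$ onto an open set $f(W)$, such that $H=K\circ I\circ f$ on $W$ for a function $K$ of the actions $I_j(x,p)=\tfrac12(x_j^2+p_j^2)$, $1\le j\le n$. Let $U=\{I(w): w\in f(W)\}\cap(0,\infty)^n$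 and let $\omega_j=\partial K/\partial I_j$ on $U$ be the frequencies. Let $\mathbb V^n\subset W$ be a compact connected Lagrangian submanifold with $f(\mathbb V^n)=\mathbb T^n(R_1,\dots,R_n)=\{x_j^2+p_j^2=R_j^2,\ 1\le j\le n\}$, where $R_j>0$. Suppose that the solid torus $\mathbb D^n=\{x_j^2+p_j^2\le R_j^2,\ 1\le j\le n\}$ is contained in $f(W)$, and put $\bar{\mathbb V}^n=f^{-1}(\mathbb D^n)$. The Maslov index of a smooth loop $\gamma:\mathbb R/\mathbb Z\to\mathbb V^n$ is $m(\gamma)=\frac1{2\pi i}\int_0^1\frac{d(\det w(t))}{\det w(t)}$, where $w(t)=u(t)u(t)^T$ for any unitary matrix $u(t)$ with $T_{\gamma(t)}\mathbb V^n=u(t)\mathbb R^n$ under the identification $(x,p)\mapsto p+ix$ of $\mathbb R^{2n}$ with $\mathbb C^n$. The basic cycle $\gamma^j$ is $f^{-1}(\bar\gamma^j)$, where $\bar\gamma^j$ runs once around the $j$-th circle of $\mathbb T^n(R_1,\dots,R_n)$, in the direction for which $\oint_{\bar\gamma^j}p\,dx=\pi R_j^2$, starting from the point $x=(R_1,\dots,R_n)$,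 $p=0$, the other coordinates being fixed. The manifold $\mathbb V^n$ satisfies the *EBK condition* if $\frac1{2\pi\hbar}\oint_\gamma p\,dx-\frac14m(\gamma)\in\mathbb Z$ for every smooth loop $\gamma$ on $\mathbb V^n$. **Theorem.** (1) If $\mathbb V^n$ satisfies the EBK condition, then $c(\bar{\mathbb V}^n)\ge\tfrac12h$ for every symplectic capacity $c$. (2) Conversely, if $c(\bar{\mathbb V}^n)\ge\tfrac12h$ for some symplectic capacity $c$ and all the frequencies are $>0$ on $U$, then the energy $E$ (the value of $H$ on $\mathbb V^n$) satisfies $E\ge K(\tfrac12\hbar,\dots,\tfrac12\hbar)$. (3) The Maslov indices $m(\gamma^j)$ of the basic cycles are integers $\ge2$. Consequently, if all the frequencies are $>0$ on $U$, then the levels $$E_{N_1,\dots,N_n}=K\bigl((N_1+\tfrac14m(\gamma^1))\hbar,\dots,(N_n+\tfrac14m(\gamma^n))\hbar\bigr)$$ satisfy $E_{N_1,\dots,N_n}\ge K(\tfrac12\hbar,\dots,\tfrac12\hbar)$ for all integers $N_1,\dots,N_n\ge0$ for which the box $\prod_{j}[\tfrac12\hbar,(N_j+\tfrac14m(\gamma^j))\hbar]$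 is contained in $U$ (that is, for all $N_j\ge0$ if $f$ is onto $\mathbb R^{2n}$). -/

import Mathlib

open scoped ContDiff

namespace EBK

/-- Phase space `ℝⁿ_x × ℝⁿ_p`; a point is `z = (x, p)`. -/
abbrev Phase (n : ℕ) : Type := (Fin n → ℝ) × (Fin n → ℝ)

/-- The standard symplectic form `σ(z, z') = p · x' - p' · x`, that is `dp ∧ dx`. -/
def sigma {n : ℕ} (z z' : Phase n) : ℝ :=
  ∑ j, (z.2 j * z'.1 j - z'.2 j * z.1 j)

/-- A symplectomorphism from an open subset of phase space (`f.source`) onto an open subset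
(`f.target`): a `C^∞` diffeomorphism whose differential preserves `σ` at every point. -/
structure IsSymplectomorphism {n : ℕ} (f : OpenPartialHomeomorph (Phase n) (Phase n)) : Prop where
  contDiffOn : ContDiffOn ℝ ∞ f f.source
  contDiffOn_symm : ContDiffOn ℝ ∞ f.symm f.target
  map_sigma : ∀ z ∈ f.source, ∀ u v : Phase n,
    sigma (fderiv ℝ f z u) (fderiv ℝ f z v) = sigma u v

/-- The closed Euclidean ball `|z| ≤ R` in phase space. -/
def ball (n : ℕ) (R : ℝ) : Set (Phase n) :=
  {z | ∑ j, (z.1 j ^ 2 + z.2 j ^ 2) ≤ R ^ 2}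

/-- The (solid, closed) cylinder `x_j ^ 2 + p_j ^ 2 ≤ R ^ 2`. -/
def cylinder {n : ℕ} (j : Fin n) (R : ℝ) : Set (Phase n) :=
  {z | z.1 j ^ 2 + z.2 j ^ 2 ≤ R ^ 2}

/-- Symplectic capacities on `ℝ^{2n}`, defined on all subsets. The invariance axiom is only required
for the symplectomorphisms of the whole space onto itself. -/
structure IsSymplecticCapacity {n : ℕ} (c : Set (Phase n) → ENNReal) : Prop where
  mono : ∀ Ω Ω' : Set (Phase n), Ω ⊆ Ω' → c Ω ≤ c Ω'
  smul : ∀ (r : ℝ) (Ω : Set (Phase n)), c ((fun z => r • z) '' Ω) = ENNReal.ofReal (r ^ 2) * c Ω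
  symplectic : ∀ f : OpenPartialHomeomorph (Phase n) (Phase n), IsSymplectomorphism f →
    f.source = Set.univ → f.target = Set.univ → ∀ Ω : Set (Phase n), c (f '' Ω) = c Ω
  ball : ∀ R : ℝ, 0 < R → c (ball n R) = ENNReal.ofReal (Real.pi * R ^ 2)
  cylinder : ∀ (j : Fin n) (R : ℝ), 0 < R → c (cylinder j R) = ENNReal.ofReal (Real.pi * R ^ 2)

/-- The tangent space at `z` of a submanifold `V` of phase space: it consists of the velocities at
`z` of the curves in `V` (for a submanifold these velocities already form a linear subspace). -/
def tangentSpace {n : ℕ} (V : Set (Phase n)) (z : Phase n) : Submodule ℝ (Phase n) :=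
  Submodule.span ℝ
    {v | ∃ γ : ℝ → Phase n, γ 0 = z ∧ (∀ t, γ t ∈ V) ∧ HasDerivAt γ v 0}

/-- `V` is a Lagrangian manifold: an embedded `n`-dimensional `C^∞` submanifold of `ℝ^{2n}` on whose
tangent spaces `σ` vanishes identically. -/
structure IsLagrangianManifold {n : ℕ} (V : Set (Phase n)) : Prop where
  submanifold : ∀ z ∈ V, ∃ χ : OpenPartialHomeomorph (Phase n) (Phase n), z ∈ χ.source ∧
    ContDiffOn ℝ ∞ χ χ.source ∧ ContDiffOn ℝ ∞ χ.symm χ.target ∧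
    ∀ y ∈ χ.source, (y ∈ V ↔ (χ y).2 = 0)
  isotropic : ∀ z ∈ V, ∀ u ∈ tangentSpace V z, ∀ v ∈ tangentSpace V z, sigma u v = 0

/-- The torus `S¹(R_1) × ⋯ × S¹(R_n)`, whose `j`-th factor lies in the plane `(x_j, p_j)`. -/
def torus {n : ℕ} (R : Fin n → ℝ) : Set (Phase n) :=
  {z | ∀ j, z.1 j ^ 2 + z.2 j ^ 2 = R j ^ 2}

/-- The solid torus `D²(R_1) × ⋯ × D²(R_n)`, a product of closed disks. -/
def solidTorus {n : ℕ} (R : Fin n → ℝ) : Set (Phase n) :=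
  {z | ∀ j, z.1 j ^ 2 + z.2 j ^ 2 ≤ R j ^ 2}

/-- The action variables `I_j = (x_j ^ 2 + p_j ^ 2) / 2` in the target space of the action-angle map;
the angles `φ_j` are the (clockwise) polar angles in the planes `(x_j, p_j)`, so that
`dI ∧ dφ = dp ∧ dx`. -/
noncomputable def action {n : ℕ} (w : Phase n) : Fin n → ℝ :=
  fun j => (w.1 j ^ 2 + w.2 j ^ 2) / 2

/-- The actions `I`, all `I_j > 0`, of the points in the range of the action-angle map. -/
def actionDomain {n : ℕ} (f : OpenPartialHomeomorph (Phase n) (Phase n)) : Set (Fin n → ℝ) :=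
  {I | (∀ j, 0 < I j) ∧ ∃ w ∈ f.target, action w = I}

/-- The frequency `ω_j(I) = ∂K/∂I_j (I)`. -/
noncomputable def frequency {n : ℕ} (K : (Fin n → ℝ) → ℝ) (j : Fin n) (I : Fin n → ℝ) : ℝ :=
  lineDeriv ℝ K I (Pi.single j 1)

/-- A smooth closed curve (of period `1`) on `V`; every one-cycle on a connected manifold is
homologous to one of these. -/
structure IsLoopOn {n : ℕ} (V : Set (Phase n)) (γ : ℝ → Phase n) : Prop where
  contDiff : ContDiff ℝ ∞ γ
  periodic : Function.Periodic γ 1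
  mem : ∀ t, γ t ∈ V

/-- The action integral `∮_γ p dx`. -/
noncomputable def liouvilleIntegral {n : ℕ} (γ : ℝ → Phase n) : ℝ :=
  ∫ t in (0 : ℝ)..1, ∑ j, (γ t).2 j * (deriv γ t).1 j

/-- The identification of `ℝ^{2n}` with `ℂⁿ` by `(x, p) ↦ p + i x`. For `σ = dp ∧ dx` this is the
compatible one: multiplication by `i` is `J (x, p) = (p, -x)`, and `σ(z, J z) = |z|²`. -/
noncomputable def toComplex {n : ℕ} (z : Phase n) : Fin n → ℂ :=
  fun j => (z.2 j : ℂ) + Complex.I * (z.1 j : ℂ)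

/-- `w` is the symmetric unitary matrix that represents the Lagrangian plane `ℓ`:
`w = u uᵀ` where `u` is a unitary matrix with `ℓ = u (ℝⁿ)`. -/
def IsSouriauMatrix {n : ℕ} (l : Submodule ℝ (Phase n)) (w : Matrix (Fin n) (Fin n) ℂ) : Prop :=
  ∃ u ∈ Matrix.unitaryGroup (Fin n) ℂ,
    (∀ z : Phase n, z ∈ l ↔ ∃ r : Fin n → ℝ, toComplex z = u.mulVec (fun j => (r j : ℂ))) ∧
    w = u * u.transpose

/-- The symmetric unitary matrix of a Lagrangian plane. -/
noncomputable def souriauMatrix {n : ℕ} (l : Submodule ℝ (Phase n)) : Matrix (Fin n) (Fin n) ℂ :=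
  Classical.epsilon (IsSouriauMatrix l)

/-- The matrix that represents a Lagrangian plane does not depend on the choice of `u`. -/
theorem IsSouriauMatrix.unique {n : ℕ} {l : Submodule ℝ (Phase n)}
    {w w' : Matrix (Fin n) (Fin n) ℂ} (h : IsSouriauMatrix l w) (h' : IsSouriauMatrix l w') :
    w = w' := by
  obtain ⟨u, hu, hl, rfl⟩ := h
  obtain ⟨v, hv, hl', rfl⟩ := h'
  have key : ∀ k : Fin n, ∃ r : Fin n → ℝ,
      (fun i => v i k) = u.mulVec (fun j => (r j : ℂ)) := by
    intro k
    have hz : toComplex ((fun i => (v i k).im, fun i => (v i k).re) : Phase n)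
        = fun i => v i k := by
      funext i
      simp only [toComplex]
      rw [mul_comm]
      exact Complex.re_add_im (v i k)
    have hm : ((fun i => (v i k).im, fun i => (v i k).re) : Phase n) ∈ l := by
      rw [hl']
      refine ⟨Pi.single k 1, ?_⟩
      rw [hz]
      funext i
      simp [Matrix.mulVec, dotProduct, Pi.single_apply, apply_ite Complex.ofReal]
    obtain ⟨r, hr⟩ := (hl _).1 hm
    exact ⟨r, by rw [← hr, hz]⟩
  choose r hr using key
  obtain ⟨O, hO⟩ : ∃ O : Matrix (Fin n) (Fin n) ℂ, ∀ j k, O j k = (r k j : ℂ) :=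
    ⟨fun j k => (r k j : ℂ), fun _ _ => rfl⟩
  have hvO : v = u * O := by
    ext i k
    have := congrFun (hr k) i
    simpa [Matrix.mul_apply, Matrix.mulVec, dotProduct, hO] using this
  have hOr : star O = O.transpose := by
    ext i k
    simp [hO, Matrix.star_apply]
  have huu : star u * u = 1 := (Matrix.mem_unitaryGroup_iff').1 hu
  have hvv : v * star v = 1 := (Matrix.mem_unitaryGroup_iff).1 hv
  have huu' : u * star u = 1 := (Matrix.mem_unitaryGroup_iff).1 hu
  have hOO : O * O.transpose = 1 := by
    have h1 : u * (O * star O) * star u = 1 := by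
      rw [← hvv, hvO, star_mul]; simp only [mul_assoc]
    rw [← hOr]
    calc O * star O = (star u * u) * (O * star O) * (star u * u) := by rw [huu]; simp
      _ = star u * (u * (O * star O) * star u) * u := by simp only [mul_assoc]
      _ = 1 := by rw [h1, mul_one, huu]
  rw [hvO, Matrix.transpose_mul]
  calc u * u.transpose = u * 1 * u.transpose := by rw [mul_one]
    _ = u * O * (O.transpose * u.transpose) := by rw [← hOO]; simp only [mul_assoc]

/-- The Maslov index `m(γ) = (1/2πi) ∫₀¹ d(det w(t)) / det w(t)` of a loop `γ` on the Lagrangian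
manifold `V`, where `w(t)` represents the tangent plane of `V` at `γ(t)`. -/
noncomputable def maslovIndex {n : ℕ} (V : Set (Phase n)) (γ : ℝ → Phase n) : ℂ :=
  1 / (2 * (Real.pi : ℂ) * Complex.I) *
    ∫ t in (0 : ℝ)..1, deriv (fun s => (souriauMatrix (tangentSpace V (γ s))).det) t /
      (souriauMatrix (tangentSpace V (γ t))).det

/-- The EBK quantization condition: `(1/2πħ) ∮_γ p dx - m(γ)/4` is an integer for all loops `γ`
on `V`. -/
def SatisfiesEBK {n : ℕ} (hbar : ℝ) (V : Set (Phase n)) : Prop :=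
  ∀ γ : ℝ → Phase n, IsLoopOn V γ →
    ∃ k : ℤ, ((1 / (2 * Real.pi * hbar) * liouvilleIntegral γ : ℝ) : ℂ)
      - 1 / 4 * maslovIndex V γ = (k : ℂ)

/-- The loop on the torus that turns once in its `j`-th circle and is constant in the other ones,
in the direction that makes `∮ p dx = π R_j ^ 2` positive. -/
noncomputable def torusCycle {n : ℕ} (R : Fin n → ℝ) (j : Fin n) (t : ℝ) : Phase n :=
  (Function.update R j (R j * Real.cos (2 * Real.pi * t)),
    Pi.single j (-(R j * Real.sin (2 * Real.pi * t))))

/-- The basic one-cycle `γ^j = f⁻¹(torus cycle)` on `f⁻¹(torus)`. -/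
noncomputable def basicCycle {n : ℕ} (f : OpenPartialHomeomorph (Phase n) (Phase n))
    (R : Fin n → ℝ) (j : Fin n) (t : ℝ) : Phase n :=
  f.symm (torusCycle R j t)

/-- The quantized actions `(N_j + m_j / 4) ħ`. -/
noncomputable def ebkAction {n : ℕ} (hbar : ℝ) (m : Fin n → ℤ) (N : Fin n → ℕ) : Fin n → ℝ :=
  fun j => ((N j : ℝ) + 1 / 4 * (m j : ℝ)) * hbar

/-- The semiclassical energy levels
`E_{N_1,…,N_n} = K((N_1 + m_1 / 4) ħ, …, (N_n + m_n / 4) ħ)`. -/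
noncomputable def ebkEnergy {n : ℕ} (K : (Fin n → ℝ) → ℝ) (hbar : ℝ) (m : Fin n → ℤ)
    (N : Fin n → ℕ) : ℝ :=
  K (ebkAction hbar m N)

end EBK

/-!
Write `g = f⁻¹` and `D` for the solid torus. The theorem rests on two facts: the set `g (D)` has
the same capacity as `D`, and every basic cycle has Maslov index exactly `2`.

*Capacity.* A capacity is only known to be invariant under symplectomorphisms of the whole space,
while `g` is defined near `D` only. The rescalings `g_t (z) = (g (t z) - g 0) / t` join
`g - g 0` to the linear map `D g (0)`, and the capacity of `g_t (D)` is locally constant in `t`: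
if `v = g_t` is `C¹`-close to `u = g_s`, then some symplectomorphism of the whole space maps `u z` to
`v z` for all `z ∈ D`. It is found without integrating a vector field. The displacement `v z - u z`,
placed at the midpoint of `u z` and `v z`, is a Hamiltonian vector field `Y`, because the pullback of
the corresponding one-form to the convex domain is closed (`exists_midpoint_primitive`). Cutting off
its Hamiltonian function gives a small global Hamiltonian vector field `X`, and the map
`y - X y / 2 ↦ y + X y / 2` is a global symplectomorphism, whose derivative is a Cayley transform
(`exists_symplectomorphism_cayley`, `exists_global_extension`, `IsSymplecticCapacity.image_eq`).
Since `D` contains a ball and is contained in cylinders, `c (g (D)) ≥ h / 2` amounts to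
`R j ^ 2 ≥ ħ` for all `j`.

*Maslov index.* The tangent space of `V = g (torus)` at `g w` is the image under `D g (w)` of the
torus directions. If a Lagrangian plane has a real frame with the complex matrix `Z`, then its
symmetric unitary matrix has the determinant `det Z / conj (det Z)` (`det_souriauMatrix`), so that
the Maslov index is twice the winding number of `det Z`. Replacing `D g (w)` by `D g (r w)` and
letting `r` tend to `0` is a homotopy to the case of a linear symplectic map, where `det Z`
describes an ellipse `cos (2πt) a + sin (2πt) b` with `Im (b / a) > 0`, which winds once around zero
(`integral_det_linear`, `maslovIndex_cycle`).

Since `g` is symplectic, the action of the `j`-th cycle is `π R j ^ 2`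
(`liouvilleIntegral_comp`), and the EBK condition on it says that `R j ^ 2` is an odd multiple of `ħ`,
hence at least `ħ`; this is (1). The two energy estimates hold since `K` is increasing in each
variable on a box that is contained in the domain of the actions (`le_of_frequency_pos`).
-/

namespace EBK

variable {n : ℕ}

/-! ### Linear symplectic algebra -/

/-- The symplectic form as a continuous bilinear map. -/
noncomputable def sigmaL (n : ℕ) : Phase n →L[ℝ] Phase n →L[ℝ] ℝ :=
  LinearMap.toContinuousLinearMap (LinearMap.toContinuousLinearMap.toLinearMap ∘ₗ
    LinearMap.mk₂ ℝ (sigma (n := n))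
      (fun a b c => by
        simp only [sigma, Prod.fst_add, Prod.snd_add, Pi.add_apply, ← Finset.sum_add_distrib]
        exact Finset.sum_congr rfl fun _ _ => by ring)
      (fun r a b => by
        simp only [sigma, Prod.smul_fst, Prod.smul_snd, Pi.smul_apply, smul_eq_mul, Finset.mul_sum]
        exact Finset.sum_congr rfl fun _ _ => by ring)
      (fun a b c => by
        simp only [sigma, Prod.fst_add, Prod.snd_add, Pi.add_apply, ← Finset.sum_add_distrib]
        exact Finset.sum_congr rfl fun _ _ => by ring)
      (fun r a b => by
        simp only [sigma, Prod.smul_fst, Prod.smul_snd, Pi.smul_apply, smul_eq_mul, Finset.mul_sum]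
        exact Finset.sum_congr rfl fun _ _ => by ring))

@[simp] lemma sigmaL_apply (a b : Phase n) : sigmaL n a b = sigma a b := rfl

lemma sigma_swap (a b : Phase n) : sigma a b = -sigma b a := by
  simp only [sigma, ← Finset.sum_neg_distrib]
  exact Finset.sum_congr rfl fun _ _ => by ring

lemma sigma_add_left (a b c : Phase n) : sigma (a + b) c = sigma a c + sigma b c := by
  simp only [← sigmaL_apply, map_add, add_apply]

lemma sigma_add_right (a b c : Phase n) : sigma a (b + c) = sigma a b + sigma a c := by
  simp only [← sigmaL_apply, map_add]

lemma sigma_sub_left (a b c : Phase n) : sigma (a - b) c = sigma a c - sigma b c := by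
  simp only [← sigmaL_apply, map_sub, sub_apply]

lemma sigma_sub_right (a b c : Phase n) : sigma a (b - c) = sigma a b - sigma a c := by
  simp only [← sigmaL_apply, map_sub]

lemma sigma_smul_left (r : ℝ) (a b : Phase n) : sigma (r • a) b = r * sigma a b := by
  simp only [← sigmaL_apply, map_smul, smul_apply, smul_eq_mul]

lemma sigma_smul_right (r : ℝ) (a b : Phase n) : sigma a (r • b) = r * sigma a b := by
  simp only [← sigmaL_apply, map_smul, smul_eq_mul]

/-- The isomorphism between covectors and vectors defined by `σ`: `σ (sharp α, v) = α v`. -/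
noncomputable def sharp (n : ℕ) : (Phase n →L[ℝ] ℝ) →L[ℝ] Phase n :=
  LinearMap.toContinuousLinearMap
    { toFun := fun α => (fun j => -α (0, Pi.single j 1), fun j => α (Pi.single j 1, 0))
      map_add' := fun α β => by
        ext j <;> simp [add_comm]
      map_smul' := fun r α => by
        ext j <;> simp }

lemma sharp_fst (α : Phase n →L[ℝ] ℝ) (j : Fin n) :
    (sharp n α).1 j = -α (0, Pi.single j 1) := rfl

lemma sharp_snd (α : Phase n →L[ℝ] ℝ) (j : Fin n) :
    (sharp n α).2 j = α (Pi.single j 1, 0) := rfl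

lemma phase_eq_sum (z : Phase n) :
    z = ∑ j, (z.1 j • ((Pi.single j 1, 0) : Phase n) + z.2 j • ((0, Pi.single j 1) : Phase n)) := by
  ext j <;> simp [Prod.fst_sum, Prod.snd_sum, Finset.sum_apply, Pi.single_apply]

lemma sigma_sharp (α : Phase n →L[ℝ] ℝ) (v : Phase n) : sigma (sharp n α) v = α v := by
  conv_rhs => rw [phase_eq_sum v]
  simp only [sigma, sharp_fst, sharp_snd, map_sum, map_add, map_smul, smul_eq_mul]
  exact Finset.sum_congr rfl fun _ _ => by ring

lemma eq_zero_of_sigma_eq_zero {a : Phase n} (h : ∀ b, sigma a b = 0) : a = 0 := by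
  ext j
  · simpa [sigma, Pi.single_apply] using h (0, Pi.single j 1)
  · simpa [sigma, Pi.single_apply] using h (Pi.single j 1, 0)

lemma injective_of_map_sigma {A : Phase n →L[ℝ] Phase n}
    (hA : ∀ a b, sigma (A a) (A b) = sigma a b) : Function.Injective A := by
  refine (injective_iff_map_eq_zero A).2 fun a ha => eq_zero_of_sigma_eq_zero fun b => ?_
  rw [← hA, ha, ← sigmaL_apply, map_zero, zero_apply]

/-- A linear map that preserves `σ` is invertible. -/
lemma exists_equiv_of_map_sigma {A : Phase n →L[ℝ] Phase n}
    (hA : ∀ a b, sigma (A a) (A b) = sigma a b) :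
    ∃ e : Phase n ≃L[ℝ] Phase n, (e : Phase n →L[ℝ] Phase n) = A :=
  ⟨(LinearEquiv.ofInjectiveEndo (A : Phase n →ₗ[ℝ] Phase n)
    (injective_of_map_sigma hA)).toContinuousLinearEquiv,
    ContinuousLinearMap.ext fun _ => rfl⟩

/-! ### Symplectomorphisms -/

namespace IsSymplectomorphism

variable {f : OpenPartialHomeomorph (Phase n) (Phase n)}

lemma contDiffAt (hf : IsSymplectomorphism f) {z : Phase n} (hz : z ∈ f.source) :
    ContDiffAt ℝ ∞ f z :=
  hf.contDiffOn.contDiffAt (f.open_source.mem_nhds hz)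

lemma contDiffAt_symm (hf : IsSymplectomorphism f) {z : Phase n} (hz : z ∈ f.target) :
    ContDiffAt ℝ ∞ f.symm z :=
  hf.contDiffOn_symm.contDiffAt (f.open_target.mem_nhds hz)

lemma hasFDerivAt (hf : IsSymplectomorphism f) {z : Phase n} (hz : z ∈ f.source) :
    HasFDerivAt f (fderiv ℝ f z) z :=
  ((hf.contDiffAt hz).differentiableAt (by simp)).hasFDerivAt

lemma hasFDerivAt_symm (hf : IsSymplectomorphism f) {z : Phase n} (hz : z ∈ f.target) :
    HasFDerivAt f.symm (fderiv ℝ f.symm z) z :=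
  ((hf.contDiffAt_symm hz).differentiableAt (by simp)).hasFDerivAt

lemma fderiv_fderiv_symm (hf : IsSymplectomorphism f) {z : Phase n} (hz : z ∈ f.target)
    (v : Phase n) : fderiv ℝ f (f.symm z) (fderiv ℝ f.symm z v) = v := by
  have h1 := (hf.hasFDerivAt (f.map_target hz)).comp z (hf.hasFDerivAt_symm hz)
  have h2 : HasFDerivAt (f ∘ f.symm) (ContinuousLinearMap.id ℝ (Phase n)) z :=
    (hasFDerivAt_id z).congr_of_eventuallyEq (f.eventually_right_inverse hz)
  exact congrArg (fun A : Phase n →L[ℝ] Phase n => A v) (h1.unique h2)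

protected lemma symm (hf : IsSymplectomorphism f) : IsSymplectomorphism f.symm where
  contDiffOn := hf.contDiffOn_symm
  contDiffOn_symm := hf.contDiffOn
  map_sigma := fun z hz u v => by
    rw [← hf.map_sigma _ (f.map_target hz), hf.fderiv_fderiv_symm hz, hf.fderiv_fderiv_symm hz]

end IsSymplectomorphism

lemma isSymplectomorphism_linear (e : Phase n ≃L[ℝ] Phase n)
    (he : ∀ a b, sigma (e a) (e b) = sigma a b) :
    IsSymplectomorphism e.toHomeomorph.toOpenPartialHomeomorph where
  contDiffOn := e.contDiff.contDiffOn
  contDiffOn_symm := e.symm.contDiff.contDiffOn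
  map_sigma := fun z _ u v => by
    have : fderiv ℝ (e.toHomeomorph.toOpenPartialHomeomorph) z = e := e.fderiv
    rw [this]; exact he u v

lemma isSymplectomorphism_addRight (a : Phase n) :
    IsSymplectomorphism (Homeomorph.addRight a).toOpenPartialHomeomorph where
  contDiffOn := (contDiff_id.add contDiff_const).contDiffOn
  contDiffOn_symm := (contDiff_id.add contDiff_const).contDiffOn
  map_sigma := fun z _ u v => by
    have : fderiv ℝ ((Homeomorph.addRight a).toOpenPartialHomeomorph) z
        = ContinuousLinearMap.id ℝ _ := ((hasFDerivAt_id z).add_const a).fderiv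
    rw [this]; rfl

/-! ### The Cayley transform of a Hamiltonian vector field -/

lemma approximatesLinearOn_id_add {Y : Phase n → Phase n} {s : Set (Phase n)}
    (hLip : LipschitzOnWith 1 Y s) :
    ApproximatesLinearOn (fun y => y + (1 / 2 : ℝ) • Y y)
      ((ContinuousLinearEquiv.refl ℝ (Phase n) : Phase n ≃L[ℝ] Phase n) :
        Phase n →L[ℝ] Phase n) s (1 / 2) := by
  intro x hx y hy
  have h1 := hLip.norm_sub_le hx hy
  have h2 : x + (1 / 2 : ℝ) • Y x - (y + (1 / 2 : ℝ) • Y y)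
      - ((ContinuousLinearEquiv.refl ℝ (Phase n) : Phase n ≃L[ℝ] Phase n) :
        Phase n →L[ℝ] Phase n) (x - y) = (1 / 2 : ℝ) • (Y x - Y y) := by
    rw [smul_sub]
    change x + (1 / 2 : ℝ) • Y x - (y + (1 / 2 : ℝ) • Y y) - (x - y) = _
    abel
  rw [h2, norm_smul]
  simp only [NNReal.coe_one, one_mul] at h1
  norm_num
  linarith

lemma nnnorm_refl_symm [Nontrivial (Phase n)] :
    ‖((ContinuousLinearEquiv.refl ℝ (Phase n)).symm : Phase n →L[ℝ] Phase n)‖₊ = 1 :=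
  NNReal.eq ContinuousLinearMap.norm_id

lemma half_lt_inv_nnnorm_refl : Subsingleton (Phase n) ∨ (1 / 2 : NNReal) <
    ‖((ContinuousLinearEquiv.refl ℝ (Phase n)).symm : Phase n →L[ℝ] Phase n)‖₊⁻¹ := by
  rcases subsingleton_or_nontrivial (Phase n) with h | h
  · exact Or.inl h
  · right
    rw [nnnorm_refl_symm, inv_one]
    exact NNReal.half_lt_self one_ne_zero

lemma exists_equiv_id_add {A : Phase n →L[ℝ] Phase n} (hA : ‖A‖ ≤ 1) :
    ∃ e : Phase n ≃L[ℝ] Phase n,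
      (e : Phase n →L[ℝ] Phase n) = ContinuousLinearMap.id ℝ _ + (1 / 2 : ℝ) • A := by
  have hinj : Function.Injective (ContinuousLinearMap.id ℝ (Phase n) + (1 / 2 : ℝ) • A) := by
    refine (injective_iff_map_eq_zero _).2 fun a ha => ?_
    have h1 : ‖A a‖ ≤ 1 * ‖a‖ := A.le_of_opNorm_le hA a
    have h2 : a = -((1 / 2 : ℝ) • A a) := eq_neg_of_add_eq_zero_left ha
    have h3 : ‖a‖ = 1 / 2 * ‖A a‖ := by
      conv_lhs => rw [h2, norm_neg, norm_smul]
      norm_num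
    exact norm_le_zero_iff.1 (by linarith [norm_nonneg a])
  exact ⟨(LinearEquiv.ofInjectiveEndo ((ContinuousLinearMap.id ℝ (Phase n) + (1 / 2 : ℝ) • A :
      Phase n →L[ℝ] Phase n) : Phase n →ₗ[ℝ] Phase n) hinj).toContinuousLinearEquiv,
      ContinuousLinearMap.ext fun _ => rfl⟩

/-- A perturbation `id + Y / 2` of the identity, with `Y` smooth and `1`-Lipschitz, is a
diffeomorphism of the whole space. -/
lemma exists_homeomorph_id_add {Y : Phase n → Phase n} (hY : ContDiff ℝ ∞ Y)
    (hLip : LipschitzWith 1 Y) :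
    ∃ e : Phase n ≃ₜ Phase n, (∀ y, e y = y + (1 / 2 : ℝ) • Y y) ∧ ContDiff ℝ ∞ e.symm := by
  let e : Phase n ≃ₜ Phase n :=
    (approximatesLinearOn_id_add hLip.lipschitzOnWith).toHomeomorph _ half_lt_inv_nnnorm_refl
  have hsm : ContDiff ℝ ∞ e := contDiff_id.add (hY.const_smul (1 / 2 : ℝ))
  have hder : ∀ y, HasFDerivAt e (ContinuousLinearMap.id ℝ _ + (1 / 2 : ℝ) • fderiv ℝ Y y) y :=
    fun y => (hasFDerivAt_id y).add
      ((((hY.differentiable (by simp)) y).hasFDerivAt).fun_const_smul (1 / 2 : ℝ))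
  choose E hE using fun y => exists_equiv_id_add (A := fderiv ℝ Y y)
    (by simpa using norm_fderiv_le_of_lipschitz ℝ hLip (x₀ := y))
  exact ⟨e, fun _ => rfl, e.contDiff_symm (f₀' := E) (fun y => by rw [hE]; exact hder y) hsm⟩

/-- If the derivative of `X` is skew for `σ`, that is, if `X` is a Hamiltonian vector field, then
the map that sends `y - X y / 2` to `y + X y / 2` preserves `σ`: its derivative is the Cayley
transform of the derivative of `X`. -/
lemma exists_symplectomorphism_cayley {X : Phase n → Phase n} (hX : ContDiff ℝ ∞ X)
    (hLip : LipschitzWith 1 X)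
    (hskew : ∀ y a b, sigma (fderiv ℝ X y a) b + sigma a (fderiv ℝ X y b) = 0) :
    ∃ Ψ : OpenPartialHomeomorph (Phase n) (Phase n), IsSymplectomorphism Ψ ∧
      Ψ.source = Set.univ ∧ Ψ.target = Set.univ ∧
      ∀ y, Ψ (y - (1 / 2 : ℝ) • X y) = y + (1 / 2 : ℝ) • X y := by
  obtain ⟨p, hp, hps⟩ := exists_homeomorph_id_add hX hLip
  obtain ⟨q, hq, hqs⟩ := exists_homeomorph_id_add hX.neg hLip.neg
  have hq' : ∀ y, q y = y - (1 / 2 : ℝ) • X y := fun y => by rw [hq]; simp [sub_eq_add_neg]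
  have hpc : ContDiff ℝ ∞ p := by
    rw [show (p : Phase n → Phase n) = fun y => y + (1 / 2 : ℝ) • X y from funext hp]
    exact contDiff_id.add (hX.const_smul _)
  have hqc : ContDiff ℝ ∞ q := by
    rw [show (q : Phase n → Phase n) = fun y => y - (1 / 2 : ℝ) • X y from funext hq']
    exact contDiff_id.sub (hX.const_smul _)
  have hXd : ∀ y, HasFDerivAt X (fderiv ℝ X y) y :=
    fun y => ((hX.differentiable (by simp)) y).hasFDerivAt
  have hpd : ∀ y, HasFDerivAt p (ContinuousLinearMap.id ℝ _ + (1 / 2 : ℝ) • fderiv ℝ X y) y := by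
    rw [show (p : Phase n → Phase n) = fun y => y + (1 / 2 : ℝ) • X y from funext hp]
    exact fun y => (hasFDerivAt_id y).add ((hXd y).fun_const_smul _)
  have hqd : ∀ y, HasFDerivAt q (ContinuousLinearMap.id ℝ _ - (1 / 2 : ℝ) • fderiv ℝ X y) y := by
    rw [show (q : Phase n → Phase n) = fun y => y - (1 / 2 : ℝ) • X y from funext hq']
    exact fun y => (hasFDerivAt_id y).sub ((hXd y).fun_const_smul _)
  refine ⟨(q.symm.trans p).toOpenPartialHomeomorph, ⟨?_, ?_, ?_⟩, rfl, rfl, fun y => ?_⟩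
  · exact (hpc.comp hqs).contDiffOn
  · exact (hqc.comp hps).contDiffOn
  · intro w _ u v
    obtain ⟨y, rfl⟩ := q.surjective w
    have hΨ : HasFDerivAt (q.symm.trans p) (fderiv ℝ (q.symm.trans p) (q y)) (q y) :=
      (((hpc.comp hqs).differentiable (by simp)) (q y)).hasFDerivAt
    -- `DΨ (a - DX a / 2) = a + DX a / 2`, since `Ψ ∘ q = p`
    have key : ∀ a, fderiv ℝ (q.symm.trans p) (q y) (a - (1 / 2 : ℝ) • fderiv ℝ X y a)
        = a + (1 / 2 : ℝ) • fderiv ℝ X y a := by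
      have h1 := hΨ.comp y (hqd y)
      have h2 : (q.symm.trans p) ∘ q = p := by ext1 x; simp
      rw [h2] at h1
      exact fun a => congrArg (fun A : Phase n →L[ℝ] Phase n => A a) (h1.unique (hpd y))
    have hsurj : ∀ u, ∃ a, a - (1 / 2 : ℝ) • fderiv ℝ X y a = u := by
      intro u
      obtain ⟨e, he⟩ := exists_equiv_id_add (A := -fderiv ℝ X y)
        (by rw [norm_neg]; simpa using norm_fderiv_le_of_lipschitz ℝ hLip (x₀ := y))
      obtain ⟨a, rfl⟩ := e.surjective u
      refine ⟨a, ?_⟩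
      have := congrArg (fun A : Phase n →L[ℝ] Phase n => A a) he
      simpa [sub_eq_add_neg] using this.symm
    obtain ⟨a, rfl⟩ := hsurj u
    obtain ⟨b, rfl⟩ := hsurj v
    change sigma (fderiv ℝ (q.symm.trans p) (q y) _) (fderiv ℝ (q.symm.trans p) (q y) _) = _
    rw [key, key]
    simp only [sigma_add_left, sigma_add_right, sigma_sub_left, sigma_sub_right, sigma_smul_left,
      sigma_smul_right]
    linarith [hskew y a b]
  · change p (q.symm _) = _
    rw [← hq', q.symm_apply_apply, hp]

/-! ### Primitives of closed one-forms -/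

/-- The Poincaré lemma for a one-form `b (p, dq)`: its exterior derivative is `b (dp ∧ dq)`, so that
it has a primitive on a convex set if `b (dp, dq)` is symmetric. -/
lemma exists_primitive {E F₁ F₂ G : Type*} [NormedAddCommGroup E] [NormedSpace ℝ E]
    [NormedAddCommGroup F₁] [NormedSpace ℝ F₁] [NormedAddCommGroup F₂] [NormedSpace ℝ F₂]
    [NormedAddCommGroup G] [NormedSpace ℝ G] [CompleteSpace G] {s : Set E} (hs : Convex ℝ s)
    (b : F₁ →L[ℝ] F₂ →L[ℝ] G) {p : E → F₁} {q : E → F₂} (hp : ∀ z ∈ s, ContDiffAt ℝ ∞ p z)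
    (hq : ∀ z ∈ s, ContDiffAt ℝ ∞ q z)
    (hsymm : ∀ z ∈ s, ∀ h k,
      b (fderiv ℝ p z h) (fderiv ℝ q z k) = b (fderiv ℝ p z k) (fderiv ℝ q z h)) :
    ∃ f : E → G, ∀ z ∈ s, HasFDerivWithinAt f ((b (p z)).comp (fderiv ℝ q z)) s z := by
  have hω : ∀ z ∈ s, HasFDerivAt (fun z => (b (p z)).comp (fderiv ℝ q z))
      (((ContinuousLinearMap.compL ℝ E F₂ G) (b (p z))).comp (fderiv ℝ (fderiv ℝ q) z)
        + ((ContinuousLinearMap.compL ℝ E F₂ G).flip (fderiv ℝ q z)).comp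
          (b.comp (fderiv ℝ p z))) z := by
    intro z hz
    have h1 : HasFDerivAt p (fderiv ℝ p z) z := ((hp z hz).differentiableAt (by simp)).hasFDerivAt
    have h2 : HasFDerivAt (fderiv ℝ q) (fderiv ℝ (fderiv ℝ q) z) z :=
      (((hq z hz).fderiv_right (m := 1) (by norm_cast)).differentiableAt (by simp)).hasFDerivAt
    exact (b.hasFDerivAt.comp z h1).clm_comp h2
  refine hs.exists_forall_hasFDerivWithinAt_of_hasFDerivWithinAt_symmetric
    (fun z hz => (hω z hz).hasFDerivWithinAt) ?_
  intro z hz h _ k _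
  have hqs : fderiv ℝ (fderiv ℝ q) z h k = fderiv ℝ (fderiv ℝ q) z k h :=
    (hq z hz).isSymmSndFDerivAt (by simp; norm_cast) h k
  simp [hsymm z hz h k, hqs]

/-- Two symplectic maps `u` and `v` on a convex open set: the one-form `σ (v - u, d((u + v) / 2))`
is exact. Its primitive is the generating function of `v ∘ u⁻¹` at the midpoints. -/
lemma exists_midpoint_primitive {U : Set (Phase n)} (hU : IsOpen U) (hconv : Convex ℝ U)
    {u v : Phase n → Phase n} (hu : ContDiffOn ℝ ∞ u U) (hv : ContDiffOn ℝ ∞ v U)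
    (hus : ∀ z ∈ U, ∀ a b, sigma (fderiv ℝ u z a) (fderiv ℝ u z b) = sigma a b)
    (hvs : ∀ z ∈ U, ∀ a b, sigma (fderiv ℝ v z a) (fderiv ℝ v z b) = sigma a b) :
    ∃ B : Phase n → ℝ, ∀ z ∈ U, HasFDerivAt B
      ((sigmaL n (v z - u z)).comp ((1 / 2 : ℝ) • (fderiv ℝ u z + fderiv ℝ v z))) z := by
  have hua : ∀ z ∈ U, ContDiffAt ℝ ∞ u z := fun z hz => hu.contDiffAt (hU.mem_nhds hz)
  have hva : ∀ z ∈ U, ContDiffAt ℝ ∞ v z := fun z hz => hv.contDiffAt (hU.mem_nhds hz)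
  have hud : ∀ z ∈ U, HasFDerivAt u (fderiv ℝ u z) z :=
    fun z hz => ((hua z hz).differentiableAt (by simp)).hasFDerivAt
  have hvd : ∀ z ∈ U, HasFDerivAt v (fderiv ℝ v z) z :=
    fun z hz => ((hva z hz).differentiableAt (by simp)).hasFDerivAt
  have hp : ∀ z ∈ U, fderiv ℝ (fun z => v z - u z) z = fderiv ℝ v z - fderiv ℝ u z :=
    fun z hz => ((hvd z hz).sub (hud z hz)).fderiv
  have hq : ∀ z ∈ U, fderiv ℝ (fun z => (1 / 2 : ℝ) • (u z + v z)) z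
      = (1 / 2 : ℝ) • (fderiv ℝ u z + fderiv ℝ v z) :=
    fun z hz => (((hud z hz).add (hvd z hz)).fun_const_smul _).fderiv
  obtain ⟨B, hB⟩ := exists_primitive hconv (sigmaL n) (p := fun z => v z - u z)
    (q := fun z => (1 / 2 : ℝ) • (u z + v z)) (fun z hz => (hva z hz).sub (hua z hz))
    (fun z hz => ((hua z hz).add (hva z hz)).const_smul _) (by
      intro z hz h k
      rw [hp z hz, hq z hz]
      simp only [sigmaL_apply, sub_apply, smul_apply,
        add_apply, sigma_smul_right, sigma_sub_left, sigma_add_right,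
        hus z hz, hvs z hz]
      rw [sigma_swap h k, sigma_swap (fderiv ℝ u z k) (fderiv ℝ v z h),
        sigma_swap (fderiv ℝ u z h) (fderiv ℝ v z k)]
      ring)
  refine ⟨B, fun z hz => ?_⟩
  rw [← hq z hz]
  exact (hB z hz).hasFDerivAt (hU.mem_nhds hz)

/-! ### Cutting off the generating function -/

lemma exists_bump {Q O : Set (Phase n)} (hQ : IsCompact Q) (hO : IsOpen O) (hQO : Q ⊆ O) :
    ∃ (χ : Phase n → ℝ) (r : ℝ), 0 < r ∧ ContDiff ℝ ∞ χ ∧ HasCompactSupport χ ∧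
      Metric.cthickening r (tsupport χ) ⊆ O ∧ ∀ q ∈ Q, ∀ y ∈ Metric.ball q r, χ y = 1 := by
  obtain ⟨r, hr, hrO⟩ := hQ.exists_cthickening_subset_open hO hQO
  obtain ⟨χ, h1, h0, -⟩ := exists_contMDiffMap_one_nhds_of_subset_interior (n := ⊤)
    (modelWithCornersSelf ℝ (Phase n)) (s := Metric.cthickening (r / 2) Q)
    (t := Metric.cthickening r Q) Metric.isClosed_cthickening
    ((Metric.cthickening_subset_thickening' hr (by linarith) Q).trans
      (interior_maximal (Metric.thickening_subset_cthickening r Q) Metric.isOpen_thickening))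
  have hsupp : tsupport χ ⊆ Metric.cthickening r Q :=
    closure_minimal (fun y hy => by_contra fun h => hy (h0 y h)) Metric.isClosed_cthickening
  have hcomp : HasCompactSupport χ := HasCompactSupport.of_support_subset_isCompact
    (hQ.cthickening (r := r)) (subset_closure.trans hsupp)
  obtain ⟨r', hr', hrO'⟩ := hcomp.exists_cthickening_subset_open hO (hsupp.trans hrO)
  refine ⟨χ, min (r / 2) r', by positivity, χ.contMDiff.contDiff, hcomp,
    (Metric.cthickening_mono (min_le_right _ _) _).trans hrO', fun q hq y hy => ?_⟩
  refine h1.self_of_nhdsSet y (Metric.mem_cthickening_of_dist_le y q _ _ hq ?_)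
  exact (Metric.mem_ball.1 hy).le.trans (min_le_left _ _)

lemma exists_bound_fderiv {E F : Type*} [NormedAddCommGroup E] [NormedSpace ℝ E]
    [NormedAddCommGroup F] [NormedSpace ℝ F] {χ : E → F} (hχ : ContDiff ℝ ∞ χ)
    (hχc : HasCompactSupport χ) : ∃ M, ∀ y, ‖fderiv ℝ χ y‖ ≤ M :=
  (hχc.fderiv ℝ).exists_bound_of_continuous (hχ.continuous_fderiv (by simp))

lemma exists_bound_cutoff {χ : Phase n → ℝ} (hχ : ContDiff ℝ ∞ χ) (hχc : HasCompactSupport χ) :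
    ∃ M, (∀ y, ‖χ y‖ ≤ M) ∧ (∀ y, ‖fderiv ℝ χ y‖ ≤ M) ∧
      ∀ y, ‖fderiv ℝ (fderiv ℝ χ) y‖ ≤ M := by
  have hdχ : ContDiff ℝ ∞ (fderiv ℝ χ) := hχ.fderiv_right (by norm_cast)
  obtain ⟨M₀, hM₀⟩ := hχc.exists_bound_of_continuous hχ.continuous
  obtain ⟨M₁, hM₁⟩ := exists_bound_fderiv hχ hχc
  obtain ⟨M₂, hM₂⟩ := exists_bound_fderiv hdχ (hχc.fderiv ℝ)
  exact ⟨max M₀ (max M₁ M₂), fun y => (hM₀ y).trans (le_max_left _ _),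
    fun y => (hM₁ y).trans ((le_max_left _ _).trans (le_max_right _ _)),
    fun y => (hM₂ y).trans ((le_max_right _ _).trans (le_max_right _ _))⟩

/-- Cutting off a Hamiltonian vector field `Y` on `T`, with Hamiltonian function `S`: the
Hamiltonian vector field of `χ S` is `1`-Lipschitz on the whole space if `S` and `Y` are small
enough in `C¹` with respect to the size `M` of the cutoff function `χ`. -/
lemma exists_cutoff_field {T : Set (Phase n)} (hT : IsOpen T) {S : Phase n → ℝ}
    {Y : Phase n → Phase n} (hY : ContDiffOn ℝ ∞ Y T)
    (hS : ∀ y ∈ T, HasFDerivAt S (sigmaL n (Y y)) y) {χ : Phase n → ℝ} (hχ : ContDiff ℝ ∞ χ)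
    (hsupp : tsupport χ ⊆ T) {M a : ℝ} (hM0 : ∀ y, ‖χ y‖ ≤ M) (hM1 : ∀ y, ‖fderiv ℝ χ y‖ ≤ M)
    (hM2 : ∀ y, ‖fderiv ℝ (fderiv ℝ χ) y‖ ≤ M) (ha0 : ∀ y ∈ T, ‖S y‖ ≤ a)
    (ha1 : ∀ y ∈ T, ‖Y y‖ ≤ a) (ha2 : ∀ y ∈ T, ‖fderiv ℝ Y y‖ ≤ a)
    (ha : a * (M * (‖sharp n‖ * (‖sigmaL n‖ + 1) + 2)) ≤ 1) :
    ∃ X : Phase n → Phase n, ContDiff ℝ ∞ X ∧ LipschitzWith 1 X ∧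
      (∀ y a b, sigma (fderiv ℝ X y a) b + sigma a (fderiv ℝ X y b) = 0) ∧
      ∀ y ∈ T, (∀ᶠ y' in nhds y, χ y' = 1) → X y = Y y := by
  have hM : 0 ≤ M := (norm_nonneg _).trans (hM0 0)
  have hSsm : ContDiffOn ℝ ∞ S T := by
    rw [contDiffOn_infty_iff_fderiv_of_isOpen hT]
    refine ⟨fun y hy => (hS y hy).differentiableAt.differentiableWithinAt, ?_⟩
    exact ((sigmaL n).contDiff.comp_contDiffOn hY).congr fun y hy => (hS y hy).fderiv
  have hdχ : ContDiff ℝ ∞ (fderiv ℝ χ) := hχ.fderiv_right (by norm_cast)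
  let X : Phase n → Phase n := fun y => S y • sharp n (fderiv ℝ χ y) + χ y • Y y
  have hYd : ∀ y ∈ T, HasFDerivAt Y (fderiv ℝ Y y) y := fun y hy =>
    ((hY.contDiffAt (hT.mem_nhds hy)).differentiableAt (by simp)).hasFDerivAt
  have hχd : ∀ y, HasFDerivAt χ (fderiv ℝ χ y) y := fun y =>
    ((hχ.differentiable (by simp)) y).hasFDerivAt
  have hddχ : ∀ y, HasFDerivAt (fderiv ℝ χ) (fderiv ℝ (fderiv ℝ χ) y) y := fun y =>
    ((hdχ.differentiable (by simp)) y).hasFDerivAt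
  -- off the support of `χ`, everything vanishes
  have hoff : ∀ y ∉ tsupport χ,
      (∀ᶠ y' in nhds y, X y' = 0) ∧ (∀ᶠ y' in nhds y, χ y' * S y' = 0) := by
    intro y hy
    have h1 : ∀ᶠ y' in nhds y, y' ∉ tsupport χ := (isClosed_tsupport χ).isOpen_compl.mem_nhds hy
    refine ⟨h1.mono fun y' hy' => ?_, h1.mono fun y' hy' => ?_⟩
    · have h2 : fderiv ℝ χ y' = 0 :=
        by_contra fun h => hy' (support_fderiv_subset ℝ h)
      simp [X, h2, image_eq_zero_of_notMem_tsupport hy']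
    · simp [image_eq_zero_of_notMem_tsupport hy']
  have hXsm : ContDiff ℝ ∞ X := by
    rw [contDiff_iff_contDiffAt]
    intro y
    by_cases hy : y ∈ tsupport χ
    · have hyT := hT.mem_nhds (hsupp hy)
      exact ((hSsm.contDiffAt hyT).smul ((sharp n).contDiff.comp hdχ).contDiffAt).add
        (hχ.contDiffAt.smul (hY.contDiffAt hyT))
    · exact contDiffAt_const.congr_of_eventuallyEq (hoff y hy).1
  have hXd : ∀ y, HasFDerivAt X (fderiv ℝ X y) y := fun y =>
    ((hXsm.differentiable (by simp)) y).hasFDerivAt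
  -- `X` is the Hamiltonian vector field of `χ S`
  have hHam : ∀ y, HasFDerivAt (fun y => χ y * S y) (sigmaL n (X y)) y := by
    intro y
    by_cases hy : y ∈ tsupport χ
    · refine ((hχd y).mul (hS y (hsupp hy))).congr_fderiv ?_
      refine ContinuousLinearMap.ext fun v => ?_
      simp [X, sigma_sharp, add_comm]
    · have h0 : X y = 0 := (hoff y hy).1.self_of_nhds
      rw [h0, map_zero]
      exact (hasFDerivAt_const (0 : ℝ) y).congr_of_eventuallyEq (hoff y hy).2
  refine ⟨X, hXsm, ?_, fun y v w => ?_, fun y _ hy => ?_⟩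
  · refine lipschitzWith_of_nnnorm_fderiv_le (hXsm.differentiable (by simp)) fun y => ?_
    rw [← NNReal.coe_le_coe, coe_nnnorm, NNReal.coe_one]
    by_cases hy : y ∈ tsupport χ
    · have hyT := hsupp hy
      have ha' : 0 ≤ a := (norm_nonneg _).trans (ha1 y hyT)
      have h1 : HasFDerivAt X (S y • (sharp n).comp (fderiv ℝ (fderiv ℝ χ) y)
          + (sigmaL n (Y y)).smulRight (sharp n (fderiv ℝ χ y))
          + (χ y • fderiv ℝ Y y + (fderiv ℝ χ y).smulRight (Y y))) y :=
        ((hS y hyT).smul ((sharp n).hasFDerivAt.comp y (hddχ y))).add ((hχd y).smul (hYd y hyT))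
      rw [h1.fderiv]
      have e1 : ‖S y • (sharp n).comp (fderiv ℝ (fderiv ℝ χ) y)‖ ≤ a * (‖sharp n‖ * M) := by
        rw [norm_smul]
        exact mul_le_mul (ha0 y hyT) (((sharp n).opNorm_comp_le _).trans
          (mul_le_mul_of_nonneg_left (hM2 y) (norm_nonneg _))) (norm_nonneg _) ha'
      have e2 : ‖(sigmaL n (Y y)).smulRight (sharp n (fderiv ℝ χ y))‖
          ≤ (‖sigmaL n‖ * a) * (‖sharp n‖ * M) := by
        rw [ContinuousLinearMap.norm_smulRight_apply]
        exact mul_le_mul ((sigmaL n).le_opNorm_of_le (ha1 y hyT))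
          ((sharp n).le_opNorm_of_le (hM1 y)) (norm_nonneg _) (by positivity)
      have e3 : ‖χ y • fderiv ℝ Y y‖ ≤ M * a := by
        rw [norm_smul]
        exact mul_le_mul (hM0 y) (ha2 y hyT) (norm_nonneg _) hM
      have e4 : ‖(fderiv ℝ χ y).smulRight (Y y)‖ ≤ M * a := by
        rw [ContinuousLinearMap.norm_smulRight_apply]
        exact mul_le_mul (hM1 y) (ha1 y hyT) (norm_nonneg _) hM
      refine (norm_add₃_le.trans (add_le_add (add_le_add e1 e2)
        ((norm_add_le _ _).trans (add_le_add e3 e4)))).trans (le_trans (le_of_eq ?_) ha)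
      ring
    · have h1 : fderiv ℝ X y = 0 := by
        rw [Filter.EventuallyEq.fderiv_eq (f := fun _ => (0 : Phase n)) (hoff y hy).1]
        simp
      rw [h1, norm_zero]
      exact zero_le_one
  · have h := second_derivative_symmetric hHam ((sigmaL n).hasFDerivAt.comp y (hXd y)) v w
    change sigma (fderiv ℝ X y v) w = sigma (fderiv ℝ X y w) v at h
    rw [h, sigma_swap v, add_neg_cancel]
  · have h1 : fderiv ℝ χ y = 0 := by
      rw [Filter.EventuallyEq.fderiv_eq (f := fun _ => (1 : ℝ)) hy]
      simp
    simp [X, h1, hy.self_of_nhds]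

/-! ### Extension of symplectic maps that are close to each other -/

/-- Let `u` be a symplectomorphism of a bounded convex open set. If `v` is a symplectic map on that
set that is `C¹`-close to `u`, then `v ∘ u⁻¹` extends from the compact set `u (Q)` to a
symplectomorphism of the whole space. The extension is the Cayley transform of a cutoff of the
Hamiltonian vector field that takes the value `v z - u z` at the midpoint of `u z` and `v z`. -/
lemma exists_global_extension {u : OpenPartialHomeomorph (Phase n) (Phase n)}
    (hu : IsSymplectomorphism u) (hconv : Convex ℝ u.source)
    (hbdd : Bornology.IsBounded u.source) {C : NNReal} (hC : LipschitzOnWith C u.symm u.target)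
    {M : ℝ} (hM : ∀ z ∈ u.source, ‖fderiv ℝ u z‖ ≤ M) {Q : Set (Phase n)} (hQ : IsCompact Q)
    (hQs : Q ⊆ u.source) :
    ∃ ε > 0, ∀ v : Phase n → Phase n, ContDiffOn ℝ ∞ v u.source →
      (∀ z ∈ u.source, ∀ a b, sigma (fderiv ℝ v z a) (fderiv ℝ v z b) = sigma a b) →
      (∀ z ∈ u.source, ‖v z - u z‖ ≤ ε) → (∀ z ∈ u.source, ‖fderiv ℝ v z - fderiv ℝ u z‖ ≤ ε) →
      ∃ Ψ : OpenPartialHomeomorph (Phase n) (Phase n), IsSymplectomorphism Ψ ∧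
        Ψ.source = Set.univ ∧ Ψ.target = Set.univ ∧ ∀ z ∈ Q, Ψ (u z) = v z := by
  rcases Q.eq_empty_or_nonempty with rfl | ⟨z₀, hz₀⟩
  · exact ⟨1, one_pos, fun _ _ _ _ _ => ⟨_, isSymplectomorphism_addRight 0, rfl, rfl, by simp⟩⟩
  have hz₀s := hQs hz₀
  obtain ⟨χ, r, hr, hχ, hχc, hχO, hχ1⟩ := exists_bump
    (hQ.image_of_continuousOn (u.continuousOn.mono hQs)) u.open_target
    (by rintro _ ⟨z, hz, rfl⟩; exact u.map_source (hQs hz))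
  obtain ⟨Mχ, h0χ, h1χ, h2χ⟩ := exists_bound_cutoff hχ hχc
  obtain ⟨d, hd⟩ : ∃ d, ∀ z ∈ u.source, ‖z - z₀‖ ≤ d := by
    obtain ⟨d, hd⟩ := hbdd.exists_norm_le
    exact ⟨d + ‖z₀‖, fun z hz => (norm_sub_le _ _).trans (by linarith [hd z hz])⟩
  have hd0 : 0 ≤ d := (norm_nonneg _).trans (hd z₀ hz₀s)
  have hM0 : 0 ≤ M := (norm_nonneg _).trans (hM z₀ hz₀s)
  have hMχ0 : 0 ≤ Mχ := (norm_nonneg _).trans (h0χ 0)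
  obtain ⟨κ, hκ⟩ : ∃ κ, κ = Mχ * (‖sharp n‖ * (‖sigmaL n‖ + 1) + 2) := ⟨_, rfl⟩
  obtain ⟨L, hL⟩ : ∃ L, L = 1 + 2 * (C : ℝ) + ‖sigmaL n‖ * (M + 1) * d := ⟨_, rfl⟩
  have hκ0 : 0 ≤ κ := by rw [hκ]; positivity
  have hL1 : 0 ≤ ‖sigmaL n‖ * (M + 1) * d := by positivity
  have hL0 : 0 ≤ L := by rw [hL]; positivity
  have hC0 : (0 : ℝ) ≤ C := C.2
  obtain ⟨ε, hε, hε1, hεr, hεC, hεL⟩ : ∃ ε : ℝ, 0 < ε ∧ ε ≤ 1 ∧ ε ≤ r ∧ C * ε ≤ 1 ∧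
      ε * L * κ ≤ 1 := by
    refine ⟨min (min 1 r) (1 / (1 + C + L * κ)), by positivity,
      (min_le_left _ _).trans (min_le_left _ _), (min_le_left _ _).trans (min_le_right _ _), ?_, ?_⟩
    · refine (mul_le_mul_of_nonneg_left (min_le_right _ _) hC0).trans ?_
      rw [mul_one_div, div_le_one (by positivity)]
      nlinarith [mul_nonneg hL0 hκ0]
    · rw [mul_assoc]
      refine (mul_le_mul_of_nonneg_right (min_le_right _ _) (by positivity)).trans ?_
      rw [one_div_mul_eq_div, div_le_one (by positivity)]
      linarith
  refine ⟨ε, hε, fun v hv hvs hv0 hv1 => ?_⟩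
  have hud : ∀ z ∈ u.source, HasFDerivAt u (fderiv ℝ u z) z := fun z hz => hu.hasFDerivAt hz
  have hvd : ∀ z ∈ u.source, HasFDerivAt v (fderiv ℝ v z) z := fun z hz =>
    ((hv.contDiffAt (u.open_source.mem_nhds hz)).differentiableAt (by simp)).hasFDerivAt
  -- the displacement `η` on the image of `u`
  let η : Phase n → Phase n := fun w => v (u.symm w) - w
  have hηu : ∀ z ∈ u.source, η (u z) = v z - u z := fun z hz => by
    simp only [η, u.left_inv hz]
  have hη0 : ∀ w ∈ u.target, ‖η w‖ ≤ ε := fun w hw => by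
    rw [← u.right_inv hw, hηu _ (u.map_target hw)]
    exact hv0 _ (u.map_target hw)
  have hηC : ∀ w ∈ u.target, ∀ w' ∈ u.target, ‖η w - η w'‖ ≤ C * ε * ‖w - w'‖ := by
    intro w hw w' hw'
    have h1 := hconv.norm_image_sub_le_of_norm_hasFDerivWithin_le (f := fun z => v z - u z)
      (fun z hz => ((hvd z hz).sub (hud z hz)).hasFDerivWithinAt) hv1
      (u.map_target hw') (u.map_target hw)
    have h2 := hC.norm_sub_le hw hw'
    simp only [u.right_inv hw, u.right_inv hw'] at h1
    calc ‖η w - η w'‖ ≤ ε * ‖u.symm w - u.symm w'‖ := h1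
      _ ≤ ε * (C * ‖w - w'‖) := by gcongr
      _ = _ := by ring
  have hηL : LipschitzOnWith 1 η u.target := LipschitzOnWith.of_dist_le_mul fun w hw w' hw' => by
    rw [dist_eq_norm, dist_eq_norm, NNReal.coe_one]
    exact (hηC w hw w' hw').trans (mul_le_mul_of_nonneg_right hεC (norm_nonneg _))
  have hηsm : ContDiffOn ℝ ∞ η u.target :=
    (hv.comp hu.contDiffOn_symm fun w hw => u.map_target hw).sub contDiffOn_id
  have hηd : ∀ w ∈ u.target, HasFDerivAt η (fderiv ℝ η w) w := fun w hw =>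
    ((hηsm.contDiffAt (u.open_target.mem_nhds hw)).differentiableAt (by simp)).hasFDerivAt
  -- the midpoint map
  let m : OpenPartialHomeomorph (Phase n) (Phase n) :=
    (approximatesLinearOn_id_add hηL).toOpenPartialHomeomorph _ _ half_lt_inv_nnnorm_refl
      u.open_target
  have hm : ∀ w, m w = w + (1 / 2 : ℝ) • η w := fun _ => rfl
  have hmsymm : ContDiffOn ℝ ∞ m.symm m.target := by
    intro y hy
    have hw : m.symm y ∈ u.target := m.map_target hy
    obtain ⟨e, he⟩ := exists_equiv_id_add (A := fderiv ℝ η (m.symm y)) (by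
      simpa using norm_fderiv_le_of_lipschitzOn ℝ (u.open_target.mem_nhds hw) hηL)
    refine (m.contDiffAt_symm (f₀' := e) hy ?_ ?_).contDiffWithinAt
    · rw [he]
      exact (hasFDerivAt_id _).add ((hηd _ hw).fun_const_smul (1 / 2 : ℝ))
    · exact contDiffAt_id.add
        ((hηsm.contDiffAt (u.open_target.mem_nhds hw)).const_smul (1 / 2 : ℝ))
  let Y : Phase n → Phase n := fun y => η (m.symm y)
  have hYsm : ContDiffOn ℝ ∞ Y m.target := hηsm.comp hmsymm fun y hy => m.map_target hy
  have hY0 : ∀ y ∈ m.target, ‖Y y‖ ≤ ε := fun y hy => hη0 _ (m.map_target hy)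
  have hYL : LipschitzOnWith (2 * C * ε.toNNReal) Y m.target := by
    refine LipschitzOnWith.of_dist_le_mul fun y hy y' hy' => ?_
    have hw := m.map_target hy
    have hw' := m.map_target hy'
    have h1 := hηC _ hw _ hw'
    have h2 : ‖m.symm y - m.symm y'‖ ≤ 2 * ‖y - y'‖ := by
      have e1 : m.symm y - m.symm y' = (y - y') - (1 / 2 : ℝ) • (η (m.symm y) - η (m.symm y')) := by
        have e4 := m.right_inv hy
        have e5 := m.right_inv hy'
        rw [hm] at e4 e5
        nth_rewrite 2 [← e4]
        nth_rewrite 2 [← e5]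
        module
      have e2 := norm_sub_le (y - y') ((1 / 2 : ℝ) • (η (m.symm y) - η (m.symm y')))
      have e3 : ‖η (m.symm y) - η (m.symm y')‖ ≤ ‖m.symm y - m.symm y'‖ := by
        simpa using hηL.norm_sub_le hw hw'
      rw [← e1, norm_smul] at e2
      norm_num at e2
      linarith
    rw [dist_eq_norm, dist_eq_norm]
    simp only [NNReal.coe_mul, NNReal.coe_ofNat, Real.coe_toNNReal _ hε.le]
    calc _ ≤ _ := h1
      _ ≤ C * ε * (2 * ‖y - y'‖) := by gcongr
      _ = _ := by ring
  have hY1 : ∀ y ∈ m.target, ‖fderiv ℝ Y y‖ ≤ 2 * C * ε := fun y hy => by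
    simpa [hε.le] using norm_fderiv_le_of_lipschitzOn ℝ (m.open_target.mem_nhds hy) hYL
  have hsupp : tsupport χ ⊆ m.target := by
    intro y hy
    have hball := (Metric.closedBall_subset_cthickening hy r).trans hχO
    have hyO : y ∈ u.target := hball (Metric.mem_closedBall_self hr.le)
    rcases subsingleton_or_nontrivial (Phase n) with h | h
    · rw [Subsingleton.elim y (m y)]
      exact m.map_source hyO
    · refine (approximatesLinearOn_id_add hηL).closedBall_subset_target half_lt_inv_nnnorm_refl
        u.open_target hr.le hball ?_
      rw [nnnorm_refl_symm, Metric.mem_closedBall, dist_comm, dist_eq_norm, add_sub_cancel_left,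
        norm_smul]
      have := hη0 y hyO
      norm_num
      linarith
  -- the generating function
  obtain ⟨B, hB⟩ := exists_midpoint_primitive u.open_source hconv hu.contDiffOn hv hu.map_sigma hvs
  let S : Phase n → ℝ := fun y => B (u.symm (m.symm y)) - B z₀
  have hS : ∀ y ∈ m.target, HasFDerivAt S (sigmaL n (Y y)) y := by
    intro y hy
    have hw : m.symm y ∈ u.target := m.map_target hy
    have hz := u.map_target hw
    have hN : HasFDerivAt (fun y => u.symm (m.symm y))
        ((fderiv ℝ u.symm (m.symm y)).comp (fderiv ℝ m.symm y)) y :=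
      (hu.hasFDerivAt_symm hw).comp y
        ((hmsymm.contDiffAt (m.open_target.mem_nhds hy)).differentiableAt (by simp)).hasFDerivAt
    have h1 := ((hB _ hz).comp y hN).sub_const (B z₀)
    have h2 := (((hud _ hz).add (hvd _ hz)).fun_const_smul (1 / 2 : ℝ)).comp y hN
    have h3 : HasFDerivAt ((fun z => (1 / 2 : ℝ) • (u z + v z)) ∘ fun y => u.symm (m.symm y))
        (ContinuousLinearMap.id ℝ (Phase n)) y := by
      refine (hasFDerivAt_id y).congr_of_eventuallyEq ?_
      filter_upwards [m.open_target.mem_nhds hy] with y' hy'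
      have hw' : m.symm y' ∈ u.target := m.map_target hy'
      conv_rhs => rw [id, ← m.right_inv hy', hm]
      simp only [Function.comp, η, u.right_inv hw']
      module
    have h4 := h2.unique h3
    refine h1.congr_fderiv ?_
    rw [ContinuousLinearMap.comp_assoc, h4, ContinuousLinearMap.comp_id, ← hηu _ hz,
      u.right_inv hw]
  have hS0 : ∀ y ∈ m.target, ‖S y‖ ≤ ε * (‖sigmaL n‖ * (M + 1) * d) := by
    intro y hy
    have hz : u.symm (m.symm y) ∈ u.source := u.map_target (m.map_target hy)
    have h1 := hconv.norm_image_sub_le_of_norm_hasFDerivWithin_le (f := B)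
      (C := ‖sigmaL n‖ * ε * (M + 1)) (fun z hz => (hB z hz).hasFDerivWithinAt) (fun z hz => by
        refine (ContinuousLinearMap.opNorm_comp_le _ _).trans ?_
        refine mul_le_mul ((sigmaL n).le_opNorm_of_le (hv0 z hz)) ?_ (norm_nonneg _) (by positivity)
        have e1 : (1 / 2 : ℝ) • (fderiv ℝ u z + fderiv ℝ v z)
            = fderiv ℝ u z + (1 / 2 : ℝ) • (fderiv ℝ v z - fderiv ℝ u z) := by module
        rw [e1]
        refine (norm_add_le _ _).trans (add_le_add (hM z hz) ?_)
        rw [norm_smul]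
        have := hv1 z hz
        norm_num
        linarith) hz₀s hz
    calc _ ≤ _ := h1
      _ ≤ ‖sigmaL n‖ * ε * (M + 1) * d := by
        gcongr
        exact hd _ hz
      _ = _ := by ring
  obtain ⟨X, hX, hXL, hXs, hXY⟩ := exists_cutoff_field m.open_target hYsm hS hχ hsupp (M := Mχ)
    (a := ε * L) h0χ h1χ h2χ
    (fun y hy => (hS0 y hy).trans (mul_le_mul_of_nonneg_left (by rw [hL]; linarith) hε.le))
    (fun y hy => (hY0 y hy).trans (le_mul_of_one_le_right hε.le (by rw [hL]; linarith)))
    (fun y hy => (hY1 y hy).trans (by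
      rw [mul_comm]; exact mul_le_mul_of_nonneg_left (by rw [hL]; linarith) hε.le))
    (by rw [← hκ]; exact hεL)
  obtain ⟨Ψ, hΨ, hΨs, hΨt, hΨX⟩ := exists_symplectomorphism_cayley hX hXL hXs
  refine ⟨Ψ, hΨ, hΨs, hΨt, fun z hz => ?_⟩
  have hzs := hQs hz
  have hw := u.map_source hzs
  have hXm : X (m (u z)) = v z - u z := by
    rw [hXY _ (m.map_source hw) ?_]
    · simp only [Y, m.left_inv (show u z ∈ m.source from hw), hηu z hzs]
    · have hmem : m (u z) ∈ Metric.ball (u z) r := by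
        rw [Metric.mem_ball, hm, dist_eq_norm, add_sub_cancel_left, norm_smul]
        have := hη0 _ hw
        norm_num
        linarith
      exact Filter.mem_of_superset (Metric.isOpen_ball.mem_nhds hmem)
        fun y hy => hχ1 _ (Set.mem_image_of_mem u hz) y hy
  have h := hΨX (m (u z))
  rw [hXm, hm, hηu z hzs, add_sub_cancel_right] at h
  rw [h]
  module

/-! ### Capacities of convex compact sets under local symplectomorphisms -/

/-- A smooth map with `D h` preserving `σ` is a local diffeomorphism; if it is also injective, it is
a symplectomorphism onto its image. -/
lemma exists_symplectomorphism_of_injOn {U : Set (Phase n)} (hU : IsOpen U)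
    {h : Phase n → Phase n} (hh : ContDiffOn ℝ ∞ h U)
    (hs : ∀ z ∈ U, ∀ a b, sigma (fderiv ℝ h z a) (fderiv ℝ h z b) = sigma a b)
    (hinj : Set.InjOn h U) :
    ∃ u : OpenPartialHomeomorph (Phase n) (Phase n),
      u.source = U ∧ (∀ z, u z = h z) ∧ IsSymplectomorphism u := by
  have hat : ∀ z ∈ U, ContDiffAt ℝ ∞ h z := fun z hz => hh.contDiffAt (hU.mem_nhds hz)
  have hder : ∀ z ∈ U, HasStrictFDerivAt h (fderiv ℝ h z) z := fun z hz =>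
    (hat z hz).hasStrictFDerivAt (by simp)
  have hopen : IsOpenMap (U.domRestrict h) := by
    rw [isOpenMap_iff_nhds_le]
    rintro ⟨z, hz⟩
    obtain ⟨e, he⟩ := exists_equiv_of_map_sigma (hs z hz)
    have h1 := hder z hz
    rw [← he] at h1
    have h2 := h1.map_nhds_eq_of_equiv
    change nhds (h z) ≤ Filter.map (h ∘ Subtype.val) _
    rw [← Filter.map_map, map_nhds_subtype_coe_eq_nhds hz (hU.mem_nhds hz), h2]
  let u : OpenPartialHomeomorph (Phase n) (Phase n) :=
    OpenPartialHomeomorph.ofContinuousOpenRestrict (hinj.toPartialEquiv) hh.continuousOn hopen hU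
  refine ⟨u, rfl, fun _ => rfl, hh, fun w hw => ?_, hs⟩
  have hz : u.symm w ∈ U := u.map_target hw
  obtain ⟨e, he⟩ := exists_equiv_of_map_sigma (hs _ hz)
  refine (u.contDiffAt_symm (f₀' := e) hw ?_ (hat _ hz)).contDiffWithinAt
  rw [he]
  exact (hder _ hz).hasFDerivAt

/-- The rescalings `z ↦ (g (t z) - g 0) / t` of `g`, which for `t → 0` tend to the linear map
`D g (0)`. -/
noncomputable def rescale (g : Phase n → Phase n) (t : ℝ) (z : Phase n) : Phase n :=
  if t = 0 then fderiv ℝ g 0 z else t⁻¹ • (g (t • z) - g 0)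

lemma smul_mem_thickening {D : Set (Phase n)} (hconv : Convex ℝ D) (h0 : (0 : Phase n) ∈ D)
    {δ : ℝ} (hδ : 0 < δ) {t : ℝ} (ht : t ∈ Set.Icc (0 : ℝ) 1) {z : Phase n}
    (hz : z ∈ Metric.thickening δ D) : t • z ∈ Metric.thickening δ D :=
  (hconv.thickening δ).smul_mem_of_zero_mem (Metric.self_subset_thickening hδ D h0) hz ht

/-- A symplectomorphism that is defined on a neighbourhood of a convex compact set does not change
its capacity, although the symplectomorphism need not extend to the whole space. It is joined by
the rescalings to a linear map, and rescalings that are close to each other differ on the set by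
a symplectomorphism of the whole space. -/
theorem IsSymplecticCapacity.image_eq {c : Set (Phase n) → ENNReal} (hc : IsSymplecticCapacity c)
    {g : OpenPartialHomeomorph (Phase n) (Phase n)} (hg : IsSymplectomorphism g)
    {D : Set (Phase n)} (hD : IsCompact D) (hconv : Convex ℝ D) (h0 : (0 : Phase n) ∈ D)
    (hDg : D ⊆ g.source) : c (g '' D) = c D := by
  obtain ⟨δ, hδ, hδg⟩ := hD.exists_cthickening_subset_open g.open_source hDg
  obtain ⟨U, hUdef⟩ : ∃ U, U = Metric.thickening δ D := ⟨_, rfl⟩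
  obtain ⟨Z, hZdef⟩ : ∃ Z, Z = Metric.cthickening δ D := ⟨_, rfl⟩
  have hUo : IsOpen U := hUdef ▸ Metric.isOpen_thickening
  have hUc : Convex ℝ U := hUdef ▸ hconv.thickening δ
  have hDU : D ⊆ U := hUdef ▸ Metric.self_subset_thickening hδ D
  have hUZ : U ⊆ Z := hUdef ▸ hZdef ▸ Metric.thickening_subset_cthickening δ D
  have hZ : IsCompact Z := hZdef ▸ hD.cthickening
  have hZg : Z ⊆ g.source := hZdef ▸ hδg
  have hU0 : (0 : Phase n) ∈ U := hDU h0
  have hsm : ∀ t ∈ Set.Icc (0 : ℝ) 1, ∀ z ∈ U, t • z ∈ U := fun t ht z hz => by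
    rw [hUdef] at hz ⊢
    exact smul_mem_thickening hconv h0 hδ ht hz
  obtain ⟨d, hd⟩ : ∃ d, ∀ z ∈ U, ‖z‖ ≤ d := (hZ.isBounded.subset hUZ).exists_norm_le
  have hd0 : 0 ≤ d := (norm_nonneg _).trans (hd 0 hU0)
  -- the derivatives of the rescalings
  have hder : ∀ t ∈ Set.Icc (0 : ℝ) 1, ∀ z ∈ U,
      HasFDerivAt (rescale g t) (fderiv ℝ g (t • z)) z := by
    intro t ht z hz
    by_cases h : t = 0
    · have : rescale g t = fderiv ℝ g 0 := by ext1 z; simp [rescale, h]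
      rw [this, h, zero_smul]
      exact (fderiv ℝ g 0).hasFDerivAt
    · have : rescale g t = fun z => t⁻¹ • (g (t • z) - g 0) := by ext1 z; simp [rescale, h]
      rw [this]
      have h1 := (((hg.hasFDerivAt (hZg (hUZ (hsm t ht z hz)))).comp z
        ((hasFDerivAt_id z).fun_const_smul t)).sub_const (g 0)).fun_const_smul t⁻¹
      refine h1.congr_fderiv (ContinuousLinearMap.ext fun v => ?_)
      simp [h]
  have hfd : ∀ t ∈ Set.Icc (0 : ℝ) 1, ∀ z ∈ U,
      fderiv ℝ (rescale g t) z = fderiv ℝ g (t • z) := fun t ht z hz => (hder t ht z hz).fderiv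
  have hzero : ∀ t, rescale g t 0 = 0 := fun t => by simp [rescale]
  have hcd : ∀ t ∈ Set.Icc (0 : ℝ) 1, ContDiffOn ℝ ∞ (rescale g t) U := by
    intro t ht
    by_cases h : t = 0
    · have : rescale g t = fderiv ℝ g 0 := by ext1 z; simp [rescale, h]
      rw [this]
      exact (fderiv ℝ g 0).contDiff.contDiffOn
    · have : rescale g t = fun z => t⁻¹ • (g (t • z) - g 0) := by ext1 z; simp [rescale, h]
      rw [this]
      exact ((hg.contDiffOn.comp (contDiff_id.const_smul t).contDiffOn
        fun z hz => hZg (hUZ (hsm t ht z hz))).sub contDiffOn_const).const_smul _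
  have hsymp : ∀ t ∈ Set.Icc (0 : ℝ) 1, ∀ z ∈ U, ∀ a b,
      sigma (fderiv ℝ (rescale g t) z a) (fderiv ℝ (rescale g t) z b) = sigma a b := by
    intro t ht z hz a b
    rw [hfd t ht z hz]
    exact hg.map_sigma _ (hZg (hUZ (hsm t ht z hz))) a b
  have hcont : ContinuousOn (fderiv ℝ g) Z :=
    (hg.contDiffOn.continuousOn_fderiv_of_isOpen g.open_source (by simp)).mono hZg
  obtain ⟨M, hM⟩ := hZ.exists_bound_of_continuousOn hcont
  -- a lower bound for the rescalings
  have hlow : ∀ t ∈ Set.Icc (0 : ℝ) 1, ∃ C : NNReal, ∀ z ∈ U, ∀ z' ∈ U,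
      ‖z - z'‖ ≤ C * ‖rescale g t z - rescale g t z'‖ := by
    intro t ht
    by_cases h : t = 0
    · obtain ⟨e, he⟩ := exists_equiv_of_map_sigma (hg.map_sigma 0 (hDg h0))
      refine ⟨‖(e.symm : Phase n →L[ℝ] Phase n)‖₊, fun z _ z' _ => ?_⟩
      have h1 : rescale g t z - rescale g t z' = e (z - z') := by
        simp only [rescale, h, if_true, ← map_sub, ← he]
        rfl
      rw [h1]
      simpa using (e.symm : Phase n →L[ℝ] Phase n).le_opNorm (e (z - z'))
    · have hloc : LocallyLipschitzOn (g '' Z) g.symm := by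
        rintro _ ⟨z, hz, rfl⟩
        obtain ⟨K, s, hs, hK⟩ := ((hg.contDiffAt_symm (g.map_source (hZg hz))).of_le
          (by norm_cast)).exists_lipschitzOnWith
        exact ⟨K, s, mem_nhdsWithin_of_mem_nhds hs, hK⟩
      obtain ⟨C, hC⟩ := hloc.exists_lipschitzOnWith_of_compact
        (hZ.image_of_continuousOn (g.continuousOn.mono hZg))
      refine ⟨C, fun z hz z' hz' => ?_⟩
      have hz1 := hUZ (hsm t ht z hz)
      have hz1' := hUZ (hsm t ht z' hz')
      have h1 := hC.norm_sub_le (Set.mem_image_of_mem g hz1) (Set.mem_image_of_mem g hz1')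
      rw [g.left_inv (hZg hz1), g.left_inv (hZg hz1'), ← smul_sub, norm_smul] at h1
      have h2 : rescale g t z - rescale g t z' = t⁻¹ • (g (t • z) - g (t • z')) := by
        simp only [rescale, h, if_false]
        module
      rw [h2, norm_smul, norm_inv]
      have ht0 : 0 < ‖t‖ := norm_pos_iff.2 h
      calc ‖z - z'‖ = ‖t‖⁻¹ * (‖t‖ * ‖z - z'‖) := by field_simp
        _ ≤ ‖t‖⁻¹ * (C * ‖g (t • z) - g (t • z')‖) := by gcongr
        _ = _ := by ring
  -- the capacity of the images is locally constant
  have hloc : IsLocallyConstant fun t : Set.Icc (0 : ℝ) 1 => c (rescale g t '' D) := by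
    rw [IsLocallyConstant.iff_eventually_eq]
    rintro ⟨s, hs⟩
    obtain ⟨C, hC⟩ := hlow s hs
    obtain ⟨u, hus, huv, hu⟩ := exists_symplectomorphism_of_injOn hUo (hcd s hs) (hsymp s hs)
      (fun z hz z' hz' h => by
        have := hC z hz z' hz'
        rw [h, sub_self, norm_zero, mul_zero] at this
        exact sub_eq_zero.1 (norm_le_zero_iff.1 this))
    have hue : (u : Phase n → Phase n) = rescale g s := funext huv
    subst hus
    have huC : LipschitzOnWith C u.symm u.target := by
      refine LipschitzOnWith.of_dist_le_mul fun w hw w' hw' => ?_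
      have := hC _ (u.map_target hw) _ (u.map_target hw')
      rw [← hue, u.right_inv hw, u.right_inv hw'] at this
      rwa [dist_eq_norm, dist_eq_norm]
    obtain ⟨ε, hε, hext⟩ := exists_global_extension hu hUc (hZ.isBounded.subset hUZ) huC (M := M)
      (fun z hz => by rw [hue, hfd s hs z hz]; exact hM _ (hUZ (hsm s hs z hz))) hD hDU
    obtain ⟨ε', hε', hε1, hε2⟩ : ∃ ε' > 0, ε' ≤ ε ∧ ε' * d ≤ ε := by
      refine ⟨ε / (1 + d), by positivity, div_le_self hε.le (by linarith), ?_⟩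
      rw [div_mul_eq_mul_div, div_le_iff₀ (by positivity)]
      nlinarith
    have huc := Metric.uniformContinuousOn_iff_le.1 (hZ.uniformContinuousOn_of_continuous hcont)
    obtain ⟨δ', hδ', hunif⟩ := huc ε' hε'
    have hnear : ∀ᶠ t : Set.Icc (0 : ℝ) 1 in nhds ⟨s, hs⟩, dist t ⟨s, hs⟩ < δ' / (1 + d) :=
      Metric.eventually_nhds_iff.2 ⟨δ' / (1 + d), by positivity, fun _ h => h⟩
    filter_upwards [hnear]
    rintro ⟨t, ht⟩ hts
    have hclose : ∀ z ∈ u.source, ‖fderiv ℝ (rescale g t) z - fderiv ℝ u z‖ ≤ ε' := by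
      intro z hz
      rw [hue, hfd t ht z hz, hfd s hs z hz, ← dist_eq_norm]
      refine hunif _ (hUZ (hsm t ht z hz)) _ (hUZ (hsm s hs z hz)) ?_
      rw [dist_eq_norm, ← sub_smul, norm_smul]
      have h1 : ‖t - s‖ ≤ δ' / (1 + d) := by
        rw [← dist_eq_norm]; exact hts.le
      calc ‖t - s‖ * ‖z‖ ≤ δ' / (1 + d) * (1 + d) := by
            refine mul_le_mul h1 ((hd z hz).trans (by linarith)) (norm_nonneg _) (by positivity)
        _ = δ' := by field_simp
    have hclose0 : ∀ z ∈ u.source, ‖rescale g t z - u z‖ ≤ ε' * d := by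
      intro z hz
      have h1 := hUc.norm_image_sub_le_of_norm_hasFDerivWithin_le
        (f := fun z => rescale g t z - u z)
        (fun z hz => ((((hcd t ht).contDiffAt (hUo.mem_nhds hz)).differentiableAt
          (by simp)).hasFDerivAt.sub (hu.hasFDerivAt hz)).hasFDerivWithinAt) hclose hU0 hz
      simp only [hue, hzero, sub_zero] at h1
      rw [hue]
      exact h1.trans (mul_le_mul_of_nonneg_left (hd z hz) hε'.le)
    obtain ⟨Ψ, hΨ, hΨs, hΨt, hΨu⟩ := hext (rescale g t) (hcd t ht) (hsymp t ht)
      (fun z hz => (hclose0 z hz).trans hε2) (fun z hz => (hclose z hz).trans hε1)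
    have himg : rescale g t '' D = Ψ '' (rescale g s '' D) := by
      rw [Set.image_image]
      exact Set.image_congr fun z hz => by rw [← hue, hΨu z hz]
    change c (rescale g t '' D) = c (rescale g s '' D)
    rw [himg, hc.symplectic Ψ hΨ hΨs hΨt]
  have h01 : c (rescale g 1 '' D) = c (rescale g 0 '' D) :=
    hloc.apply_eq_of_preconnectedSpace ⟨1, by simp⟩ ⟨0, by simp⟩
  have h1 : rescale g 1 '' D
      = (Homeomorph.addRight (-g 0)).toOpenPartialHomeomorph '' (g '' D) := by
    rw [Set.image_image]
    exact Set.image_congr fun z _ => by simp [rescale, sub_eq_add_neg]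
  obtain ⟨e, he⟩ := exists_equiv_of_map_sigma (hg.map_sigma 0 (hDg h0))
  have h2 : rescale g 0 '' D = e.toHomeomorph.toOpenPartialHomeomorph '' D := by
    refine Set.image_congr fun z _ => ?_
    simp only [rescale, if_true, ← he]
    rfl
  rw [h1, h2, hc.symplectic _ (isSymplectomorphism_addRight _) rfl rfl,
    hc.symplectic _ (isSymplectomorphism_linear e fun a b => ?_) rfl rfl] at h01
  · exact h01
  · have := hg.map_sigma 0 (hDg h0) a b
    rwa [← he] at this

/-! ### The symmetric unitary matrix of a Lagrangian plane -/

open scoped MatrixOrder in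
lemma exists_real_sqrt {G : Matrix (Fin n) (Fin n) ℝ} (hG : G.PosSemidef) :
    ∃ N : Matrix (Fin n) (Fin n) ℝ, N.transpose * N = G := by
  refine ⟨CFC.sqrt G, ?_⟩
  have h0 : 0 ≤ G := Matrix.nonneg_iff_posSemidef.2 hG
  have h1 : (CFC.sqrt G).IsHermitian :=
    (Matrix.nonneg_iff_posSemidef.1 (CFC.sqrt_nonneg G)).isHermitian
  have h2 : (CFC.sqrt G).transpose = CFC.sqrt G := by
    rw [← Matrix.conjTranspose_eq_transpose_of_trivial]; exact h1
  rw [h2, CFC.sqrt_mul_sqrt_self G h0]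

/-- The complex matrix whose columns are the vectors `b k`. -/
noncomputable def frameMatrix (b : Fin n → Phase n) : Matrix (Fin n) (Fin n) ℂ :=
  Matrix.of fun i k => toComplex (b k) i

lemma toComplex_sum (b : Fin n → Phase n) (r : Fin n → ℝ) :
    toComplex (∑ k, r k • b k) = (frameMatrix b).mulVec (fun k => (r k : ℂ)) := by
  funext i
  simp only [toComplex, frameMatrix, Matrix.mulVec, dotProduct, Matrix.of_apply, Prod.fst_sum,
    Prod.snd_sum, Prod.smul_fst, Prod.smul_snd, Finset.sum_apply, Pi.smul_apply, smul_eq_mul,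
    Complex.ofReal_sum, Complex.ofReal_mul, Finset.mul_sum, ← Finset.sum_add_distrib]
  exact Finset.sum_congr rfl fun _ _ => by ring

lemma toComplex_injective : Function.Injective (toComplex (n := n)) := by
  intro a b h
  ext i
  · simpa [toComplex] using congrArg Complex.im (congrFun h i)
  · simpa [toComplex] using congrArg Complex.re (congrFun h i)

/-- The imaginary part of the Hermitian product is the symplectic form. -/
lemma im_star_dotProduct (a b : Phase n) :
    (∑ i, star (toComplex a i) * toComplex b i).im = sigma a b := by
  simp only [Complex.im_sum, sigma, toComplex]
  exact Finset.sum_congr rfl fun _ _ => by simp; ring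

/-- The real part of the Hermitian products of the vectors `b k`. -/
noncomputable def gram (b : Fin n → Phase n) : Matrix (Fin n) (Fin n) ℝ :=
  Matrix.of fun k l => (∑ i, star (toComplex (b k) i) * toComplex (b l) i).re

lemma gram_map (b : Fin n → Phase n) (hb : ∀ k l, sigma (b k) (b l) = 0) :
    (frameMatrix b).conjTranspose * frameMatrix b = (gram b).map Complex.ofReal := by
  ext k l
  simp only [Matrix.mul_apply, Matrix.conjTranspose_apply, frameMatrix, Matrix.of_apply,
    Matrix.map_apply, gram]
  apply Complex.ext
  · simp
  · rw [im_star_dotProduct, hb, Complex.ofReal_im]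

lemma gram_posDef (b : Fin n → Phase n)
    (hlin : ∀ r : Fin n → ℝ, ∑ k, r k • b k = 0 → r = 0) : (gram b).PosDef := by
  let A : Matrix (Fin n ⊕ Fin n) (Fin n) ℝ := Matrix.of fun s k => Sum.elim (b k).1 (b k).2 s
  have hA : gram b = A.conjTranspose * A := by
    ext k l
    simp only [gram, toComplex, A, Matrix.mul_apply, Matrix.conjTranspose_apply, Matrix.of_apply,
      Fintype.sum_sum_type, Complex.re_sum, Sum.elim_inl, Sum.elim_inr, ← Finset.sum_add_distrib]
    exact Finset.sum_congr rfl fun _ _ => by simp; ring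
  rw [hA]
  refine Matrix.PosDef.conjTranspose_mul_self A ?_
  refine (injective_iff_map_eq_zero A.mulVecLin).2 fun r hr => hlin r ?_
  have h : ∀ s, ∑ k, Sum.elim (b k).1 (b k).2 s * r k = 0 := fun s => congrFun hr s
  ext i
  · simpa [Prod.fst_sum, Finset.sum_apply, mul_comm] using h (Sum.inl i)
  · simpa [Prod.snd_sum, Finset.sum_apply, mul_comm] using h (Sum.inr i)

/-- An isotropic real frame of `n` vectors is a complex frame, since its Gram matrix for the
Hermitian product is real. It differs from a unitary frame by a real matrix. -/
lemma det_souriauMatrix {l : Submodule ℝ (Phase n)} {b : Fin n → Phase n}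
    (hl : ∀ z, z ∈ l ↔ ∃ r : Fin n → ℝ, z = ∑ k, r k • b k)
    (hb : ∀ k l, sigma (b k) (b l) = 0)
    (hlin : ∀ r : Fin n → ℝ, ∑ k, r k • b k = 0 → r = 0) :
    (frameMatrix b).det ≠ 0 ∧
      (souriauMatrix l).det = (frameMatrix b).det / star (frameMatrix b).det := by
  have hg := gram_map b hb
  have hpd := gram_posDef b hlin
  obtain ⟨N, hN⟩ := exists_real_sqrt hpd.posSemidef
  have hNdet : N.det * N.det = (gram b).det := by
    rw [← hN, Matrix.det_mul, Matrix.det_transpose]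
  have hNu : IsUnit N.det := by
    rw [isUnit_iff_ne_zero]
    intro h
    rw [h, mul_zero] at hNdet
    exact hpd.det_pos.ne hNdet
  have hdet : star (frameMatrix b).det * (frameMatrix b).det = ((N.det : ℝ) : ℂ) ^ 2 := by
    have := congrArg Matrix.det hg
    rw [Matrix.det_mul, Matrix.det_conjTranspose] at this
    rw [this, sq, ← Complex.ofReal_mul, hNdet]
    exact (RingHom.map_det Complex.ofRealHom (gram b)).symm
  have hN0 : ((N.det : ℝ) : ℂ) ^ 2 ≠ 0 := by
    simpa using hNu.ne_zero
  have hne : (frameMatrix b).det ≠ 0 := fun h => hN0 (by rw [← hdet, h, mul_zero])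
  refine ⟨hne, ?_⟩
  obtain ⟨P, hP⟩ : ∃ P, P = (N⁻¹).map Complex.ofReal := ⟨_, rfl⟩
  have hPN : P * N.map Complex.ofReal = 1 := by
    have := congrArg (fun A : Matrix (Fin n) (Fin n) ℝ => A.map Complex.ofRealHom)
      (Matrix.nonsing_inv_mul N hNu)
    rw [Matrix.map_mul] at this
    rw [hP]
    refine this.trans ?_
    simp
  have hNP : N.map Complex.ofReal * P = 1 := by
    rw [mul_eq_one_comm, hPN]
  have hPdet : P.det * ((N.det : ℝ) : ℂ) = 1 := by
    have := congrArg Matrix.det hPN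
    rw [Matrix.det_mul, Matrix.det_one] at this
    rw [← this]
    congr 1
    exact (RingHom.map_det Complex.ofRealHom N)
  have hPs : star P = P.transpose := by
    rw [hP]; ext i k; simp [Matrix.star_apply]
  have hgN : (gram b).map Complex.ofReal
      = (N.map Complex.ofReal).transpose * N.map Complex.ofReal := by
    rw [← hN]
    exact Matrix.map_mul (f := Complex.ofRealHom)
  have hS : IsSouriauMatrix l (frameMatrix b * P * (frameMatrix b * P).transpose) := by
    refine ⟨frameMatrix b * P, ?_, fun z => ?_, rfl⟩
    · rw [Matrix.mem_unitaryGroup_iff', star_mul, hPs]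
      calc P.transpose * star (frameMatrix b) * (frameMatrix b * P)
          = P.transpose * ((frameMatrix b).conjTranspose * frameMatrix b) * P := by
            simp only [Matrix.star_eq_conjTranspose, mul_assoc]
        _ = (N.map Complex.ofReal * P).transpose * (N.map Complex.ofReal * P) := by
            rw [hg, hgN, Matrix.transpose_mul]; simp only [mul_assoc]
        _ = 1 := by rw [hNP]; simp
    · have hreal : ∀ (A : Matrix (Fin n) (Fin n) ℝ) (r : Fin n → ℝ),
          (A.map Complex.ofReal).mulVec (fun k => (r k : ℂ)) = fun k => ((A.mulVec r k : ℝ) : ℂ) := by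
        intro A r
        funext k
        simp [Matrix.mulVec, dotProduct]
      rw [hl]
      constructor
      · rintro ⟨r, rfl⟩
        refine ⟨N.mulVec r, ?_⟩
        rw [toComplex_sum, ← hreal, Matrix.mulVec_mulVec, mul_assoc, hPN, mul_one]
      · rintro ⟨r, hr⟩
        refine ⟨(N⁻¹).mulVec r, toComplex_injective ?_⟩
        rw [hr, toComplex_sum, ← hreal, Matrix.mulVec_mulVec, hP]
  have hsour : souriauMatrix l = frameMatrix b * P * (frameMatrix b * P).transpose :=
    IsSouriauMatrix.unique (Classical.epsilon_spec (p := IsSouriauMatrix l) ⟨_, hS⟩) hS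
  rw [hsour, Matrix.det_mul, Matrix.det_transpose, Matrix.det_mul]
  have hsne : star (frameMatrix b).det ≠ 0 := star_ne_zero.2 hne
  rw [eq_div_iff hsne]
  have hPdet2 : P.det ^ 2 * ((N.det : ℝ) : ℂ) ^ 2 = 1 := by rw [← mul_pow, hPdet, one_pow]
  linear_combination (frameMatrix b).det * P.det ^ 2 * hdet + (frameMatrix b).det * hPdet2

/-- If `σ (b k, y)` is positive for `k = j` and zero for the other `k`, then replacing the `j`-th
column of the frame matrix by `y` multiplies the determinant by a number of the upper half plane. -/
lemma im_det_updateCol_div_pos {b : Fin n → Phase n} (hb : ∀ k l, sigma (b k) (b l) = 0)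
    (hlin : ∀ r : Fin n → ℝ, ∑ k, r k • b k = 0 → r = 0) (hdet : (frameMatrix b).det ≠ 0)
    {y : Phase n} {j : Fin n} (hj : 0 < sigma (b j) y) (hk : ∀ k ≠ j, sigma (b k) y = 0) :
    0 < (((frameMatrix b).updateCol j (toComplex y)).det / (frameMatrix b).det).im := by
  obtain ⟨q, hq⟩ : ∃ q, q = (frameMatrix b).det⁻¹ • (frameMatrix b).cramer (toComplex y) := ⟨_, rfl⟩
  have hMq : (frameMatrix b).mulVec q = toComplex y := by
    rw [hq, Matrix.mulVec_smul, Matrix.mulVec_cramer, smul_smul, inv_mul_cancel₀ hdet, one_smul]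
  have hqj : ((frameMatrix b).updateCol j (toComplex y)).det / (frameMatrix b).det = q j := by
    rw [hq, Pi.smul_apply, Matrix.cramer_apply, smul_eq_mul, div_eq_inv_mul]
  have hG : ∀ k, ((gram b).mulVec fun l => (q l).im) k = sigma (b k) y := by
    intro k
    have h1 : ((gram b).map Complex.ofReal).mulVec q
        = (frameMatrix b).conjTranspose.mulVec (toComplex y) := by
      rw [← gram_map b hb, ← Matrix.mulVec_mulVec, hMq]
    have h2 := congrArg Complex.im (congrFun h1 k)
    have h3 : ((frameMatrix b).conjTranspose.mulVec (toComplex y) k).im = sigma (b k) y := by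
      rw [← im_star_dotProduct]; rfl
    rw [← h3, ← h2]
    simp [Matrix.mulVec, dotProduct]
  have hG' : ((gram b).mulVec fun l => (q l).im) = Pi.single j (sigma (b j) y) := by
    funext k
    rw [hG]
    by_cases h : k = j
    · subst h; simp
    · rw [Pi.single_eq_of_ne h, hk k h]
  have hne : (fun l => (q l).im) ≠ 0 := by
    intro h
    rw [h, Matrix.mulVec_zero] at hG'
    have := congrFun hG' j
    simp only [Pi.zero_apply, Pi.single_eq_same] at this
    exact hj.ne this
  have hpos := (gram_posDef b hlin).dotProduct_mulVec_pos hne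
  rw [hG'] at hpos
  have h4 : 0 < (q j).im * sigma (b j) y := by simpa using hpos
  rw [hqj]
  exact pos_of_mul_pos_left h4 hj.le

/-! ### Winding numbers -/

/-- The winding number around zero is invariant under homotopies of loops. -/
lemma integral_deriv_div_eq {Δ : ℝ × ℝ → ℂ}
    (hΔ : ∀ r ∈ Set.Icc (0 : ℝ) 1, ∀ t, ContDiffAt ℝ ∞ Δ (r, t))
    (hne : ∀ r ∈ Set.Icc (0 : ℝ) 1, ∀ t, Δ (r, t) ≠ 0) (hper : ∀ r t, Δ (r, t + 1) = Δ (r, t)) :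
    ∫ t in (0 : ℝ)..1, deriv (fun t => Δ (0, t)) t / Δ (0, t)
      = ∫ t in (0 : ℝ)..1, deriv (fun t => Δ (1, t)) t / Δ (1, t) := by
  have hs : Convex ℝ (Set.Icc (0 : ℝ) 1 ×ˢ (Set.univ : Set ℝ)) := (convex_Icc 0 1).prod convex_univ
  have hd : ∀ r ∈ Set.Icc (0 : ℝ) 1, ∀ t, HasFDerivAt Δ (fderiv ℝ Δ (r, t)) (r, t) :=
    fun r hr t => ((hΔ r hr t).differentiableAt (by simp)).hasFDerivAt
  -- a continuous logarithm of `Δ`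
  obtain ⟨f, hf⟩ := exists_primitive hs (ContinuousLinearMap.mul ℝ ℂ) (p := fun z => (Δ z)⁻¹)
    (q := Δ) (fun z hz => (hΔ z.1 hz.1 z.2).inv (hne z.1 hz.1 z.2)) (fun z hz => hΔ z.1 hz.1 z.2) (by
      rintro ⟨r, t⟩ ⟨hr, -⟩ h k
      have h1 := (hasFDerivAt_inv' (𝕜 := ℝ) (hne r hr t)).comp (r, t) (hd r hr t)
      have h2 : fderiv ℝ (fun z => (Δ z)⁻¹) (r, t) = _ := h1.fderiv
      rw [h2]
      simp
      ring)
  have hpath : ∀ r ∈ Set.Icc (0 : ℝ) 1, ∀ t, HasDerivAt (fun t => f (r, t))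
      (deriv (fun t => Δ (r, t)) t / Δ (r, t)) t := by
    intro r hr t
    have h1 : HasDerivAt (fun t : ℝ => (r, t)) ((0 : ℝ), (1 : ℝ)) t :=
      (hasDerivAt_const t r).prodMk (hasDerivAt_id t)
    have h2 := (hf (r, t) ⟨hr, trivial⟩).comp_hasDerivAt t h1
      (Filter.Eventually.of_forall fun t' => ⟨hr, trivial⟩)
    have h3 : deriv (fun t => Δ (r, t)) t = fderiv ℝ Δ (r, t) (0, 1) :=
      ((hd r hr t).comp_hasDerivAt t h1).deriv
    rw [h3, div_eq_inv_mul]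
    exact h2
  have hFTC : ∀ r ∈ Set.Icc (0 : ℝ) 1,
      ∫ t in (0 : ℝ)..1, deriv (fun t => Δ (r, t)) t / Δ (r, t) = f (r, 1) - f (r, 0) := by
    intro r hr
    refine intervalIntegral.integral_eq_sub_of_hasDerivAt (fun t _ => hpath r hr t) ?_
    refine Continuous.intervalIntegrable ?_ _ _
    have hc : ContDiff ℝ ∞ (fun t => Δ (r, t)) := contDiff_iff_contDiffAt.2 fun t =>
      (hΔ r hr t).comp t (contDiff_const.prodMk contDiff_id).contDiffAt
    exact (hc.continuous_deriv (by simp)).div hc.continuous (hne r hr)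
  -- the increment of the logarithm along the loops does not depend on `r`
  have hder : ∀ r ∈ Set.Icc (0 : ℝ) 1,
      HasDerivWithinAt (fun r => f (r, 1) - f (r, 0)) 0 (Set.Icc 0 1) r := by
    intro r hr
    have h1 : ∀ t, HasDerivWithinAt (fun r => f (r, t))
        ((Δ (r, t))⁻¹ * fderiv ℝ Δ (r, t) (1, 0)) (Set.Icc 0 1) r := by
      intro t
      have h2 : HasDerivWithinAt (fun r : ℝ => (r, t)) ((1 : ℝ), (0 : ℝ)) (Set.Icc 0 1) r :=
        ((hasDerivAt_id r).prodMk (hasDerivAt_const r t)).hasDerivWithinAt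
      have h3 : Set.MapsTo (fun r : ℝ => (r, t)) (Set.Icc 0 1)
          (Set.Icc (0 : ℝ) 1 ×ˢ (Set.univ : Set ℝ)) := fun r' hr' => ⟨hr', trivial⟩
      exact (hf (r, t) ⟨hr, trivial⟩).comp_hasDerivWithinAt r h2 h3
    have h3 : fderiv ℝ Δ (r, 1) = fderiv ℝ Δ (r, 0) := by
      have h4 : (fun z => Δ (z + (0, 1))) = Δ := by
        ext1 ⟨r', t'⟩
        simp [hper]
      have h5 := fderiv_comp_add_right (𝕜 := ℝ) (f := Δ) (x := (r, 0)) (0, 1)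
      rw [h4] at h5
      simpa using h5.symm
    have h6 : Δ (r, 1) = Δ (r, 0) := by simpa using hper r 0
    have h7 := (h1 1).sub (h1 0)
    rwa [h3, h6, sub_self] at h7
  have hconst := (convex_Icc (0 : ℝ) 1).norm_image_sub_le_of_norm_hasDerivWithin_le (C := 0) hder
    (by simp) (show (0 : ℝ) ∈ Set.Icc (0 : ℝ) 1 by simp) (show (1 : ℝ) ∈ Set.Icc (0 : ℝ) 1 by simp)
  rw [zero_mul, norm_le_zero_iff, sub_eq_zero] at hconst
  rw [hFTC 0 (by simp), hFTC 1 (by simp), hconst]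

/-- The ellipse `cos (2πt) a + sin (2πt) b` winds once around zero. -/
lemma integral_deriv_div_ellipse {a b : ℂ} (hab : 0 < (b / a).im) :
    ∫ t in (0 : ℝ)..1, deriv (fun t : ℝ => (Real.cos (2 * Real.pi * t) : ℂ) * a
        + (Real.sin (2 * Real.pi * t) : ℂ) * b) t /
      ((Real.cos (2 * Real.pi * t) : ℂ) * a + (Real.sin (2 * Real.pi * t) : ℂ) * b)
      = 2 * Real.pi * Complex.I := by
  have ha : a ≠ 0 := by
    rintro rfl
    simp at hab
  let Δ : ℝ × ℝ → ℂ := fun z => (Real.cos (2 * Real.pi * z.2) : ℂ) * a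
    + (Real.sin (2 * Real.pi * z.2) : ℂ) * (b + z.1 * (Complex.I * a - b))
  have h := integral_deriv_div_eq (Δ := Δ) ?_ ?_ ?_
  · have h0 : ∀ t, Δ (0, t) = (Real.cos (2 * Real.pi * t) : ℂ) * a
        + (Real.sin (2 * Real.pi * t) : ℂ) * b := fun t => by simp [Δ]
    have h1 : ∀ t, Δ (1, t) = Complex.exp (2 * Real.pi * Complex.I * t) * a := fun t => by
      have : (2 * Real.pi * Complex.I * t : ℂ) = ((2 * Real.pi * t : ℝ) : ℂ) * Complex.I := by
        push_cast; ring
      rw [this, Complex.exp_mul_I]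
      simp only [Δ, Complex.ofReal_one, one_mul, add_sub_cancel, Complex.ofReal_cos,
        Complex.ofReal_sin]
      ring
    simp only [h0, h1] at h
    rw [h]
    have hd : ∀ t : ℝ, deriv (fun t : ℝ => Complex.exp (2 * Real.pi * Complex.I * t) * a) t
        / (Complex.exp (2 * Real.pi * Complex.I * t) * a) = 2 * Real.pi * Complex.I := by
      intro t
      have e1 : HasDerivAt (fun t : ℝ => (2 * Real.pi * Complex.I * t : ℂ))
          (2 * Real.pi * Complex.I) t := by
        simpa using (Complex.ofRealCLM.hasDerivAt (x := t)).const_mul (2 * Real.pi * Complex.I)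
      rw [(e1.cexp.mul_const a).deriv]
      have := Complex.exp_ne_zero (2 * Real.pi * Complex.I * t)
      field_simp
    rw [intervalIntegral.integral_congr fun t _ => hd t]
    simp
  · intro r _ t
    apply ContDiff.contDiffAt
    have e1 : ContDiff ℝ ∞ (fun x : ℝ => (x : ℂ)) := Complex.ofRealCLM.contDiff
    have e2 : ContDiff ℝ ∞ (fun z : ℝ × ℝ => 2 * Real.pi * z.2) := contDiff_const.mul contDiff_snd
    exact ((e1.comp (Real.contDiff_cos.comp e2)).mul contDiff_const).add
      ((e1.comp (Real.contDiff_sin.comp e2)).mul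
        (contDiff_const.add ((e1.comp contDiff_fst).mul contDiff_const)))
  · intro r hr t h0
    -- the imaginary part of the quotient by `a` is a positive multiple of the sine
    have h1 : (Real.cos (2 * Real.pi * t) : ℂ)
        + (Real.sin (2 * Real.pi * t) : ℂ) * (b / a + r * (Complex.I - b / a)) = 0 := by
      have : Δ (r, t) = a * ((Real.cos (2 * Real.pi * t) : ℂ)
        + (Real.sin (2 * Real.pi * t) : ℂ) * (b / a + r * (Complex.I - b / a))) := by
        simp only [Δ]
        field_simp
      rw [this] at h0
      exact (mul_eq_zero.1 h0).resolve_left ha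
    have h2 : Real.sin (2 * Real.pi * t) * ((b / a).im + r * (1 - (b / a).im)) = 0 := by
      simpa only [Complex.add_im, Complex.re_ofReal_mul, Complex.im_ofReal_mul, Complex.ofReal_im,
        Complex.sub_im, Complex.I_im, zero_add, Complex.zero_im] using congrArg Complex.im h1
    have h3 : 0 < (b / a).im + r * (1 - (b / a).im) := by
      rcases hr.2.lt_or_eq with h | h
      · nlinarith [mul_pos (sub_pos.2 h) hab, hr.1]
      · rw [h]; linarith
    have h4 : Real.sin (2 * Real.pi * t) = 0 := (mul_eq_zero.1 h2).resolve_right h3.ne'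
    rw [h4] at h1
    have h5 : Real.cos (2 * Real.pi * t) = 0 := by
      rwa [Complex.ofReal_zero, zero_mul, add_zero, Complex.ofReal_eq_zero] at h1
    have h6 := Real.sin_sq_add_cos_sq (2 * Real.pi * t)
    rw [h4, h5] at h6
    norm_num at h6
  · intro r t
    have : 2 * Real.pi * (t + 1) = 2 * Real.pi * t + 2 * Real.pi := by ring
    simp only [Δ, this, Real.cos_add_two_pi, Real.sin_add_two_pi]

/-! ### Loops on the torus and on its image -/

/-- The standard torus direction at `w` in the plane `(x_k, p_k)`. -/
noncomputable def turn (w : Phase n) (k : Fin n) : Phase n :=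
  (Pi.single k (w.2 k), Pi.single k (-w.1 k))

lemma sum_smul_turn (w : Phase n) (r : Fin n → ℝ) :
    ∑ k, r k • turn w k = (fun k => r k * w.2 k, fun k => -(r k * w.1 k)) := by
  ext j <;> simp [turn, Prod.fst_sum, Prod.snd_sum, Finset.sum_apply, Pi.single_apply]

lemma sigma_turn (w : Phase n) (k l : Fin n) : sigma (turn w k) (turn w l) = 0 := by
  refine Finset.sum_eq_zero fun j _ => ?_
  by_cases hk : j = k
  · by_cases hl : j = l
    · subst hk hl; simp [turn]
    · simp [turn, Pi.single_apply, hl]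
  · simp [turn, Pi.single_apply, hk]

lemma mem_torus_pos {R : Fin n → ℝ} (hR : ∀ j, 0 < R j) {w : Phase n} (hw : w ∈ torus R)
    (j : Fin n) : 0 < w.1 j ^ 2 + w.2 j ^ 2 := by
  rw [hw j]; exact pow_pos (hR j) 2

lemma turn_independent {R : Fin n → ℝ} (hR : ∀ j, 0 < R j) {w : Phase n} (hw : w ∈ torus R)
    {r : Fin n → ℝ} (h : ∑ k, r k • turn w k = 0) : r = 0 := by
  rw [sum_smul_turn] at h
  funext k
  have h1 : r k * w.2 k = 0 := congrFun (congrArg Prod.fst h) k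
  have h2 : -(r k * w.1 k) = 0 := congrFun (congrArg Prod.snd h) k
  have h3 := mem_torus_pos hR hw k
  rcases mul_eq_zero.1 h1 with h | h
  · exact h
  · rcases mul_eq_zero.1 (neg_eq_zero.1 h2) with h' | h'
    · exact h'
    · rw [h, h'] at h3
      norm_num at h3

lemma torus_subset_solidTorus (R : Fin n → ℝ) : torus R ⊆ solidTorus R := fun _ hw j => (hw j).le

lemma smul_mem_solidTorus {R : Fin n → ℝ} {w : Phase n} (hw : w ∈ solidTorus R) {r : ℝ}
    (hr : r ∈ Set.Icc (0 : ℝ) 1) : r • w ∈ solidTorus R := by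
  intro j
  have h1 : r ^ 2 ≤ 1 := pow_le_one₀ hr.1 hr.2
  have h2 := hw j
  have h3 : 0 ≤ w.1 j ^ 2 + w.2 j ^ 2 := by positivity
  calc (r • w).1 j ^ 2 + (r • w).2 j ^ 2 = r ^ 2 * (w.1 j ^ 2 + w.2 j ^ 2) := by
        simp; ring
    _ ≤ _ := by nlinarith

/-- The tangent space of the image of a torus is spanned by the images of the torus directions. -/
lemma mem_tangentSpace_image_torus {g : OpenPartialHomeomorph (Phase n) (Phase n)}
    (hg : IsSymplectomorphism g) {R : Fin n → ℝ} (hR : ∀ j, 0 < R j) (hRg : torus R ⊆ g.source)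
    {w : Phase n} (hw : w ∈ torus R) (z : Phase n) :
    z ∈ tangentSpace (g '' torus R) (g w) ↔
      ∃ r : Fin n → ℝ, z = ∑ k, r k • fderiv ℝ g w (turn w k) := by
  have hsum : ∀ r : Fin n → ℝ,
      ∑ k, r k • fderiv ℝ g w (turn w k) = fderiv ℝ g w (∑ k, r k • turn w k) := fun r => by
    simp only [map_sum, map_smul]
  let T : (Fin n → ℝ) →ₗ[ℝ] Phase n :=
    Fintype.linearCombination ℝ fun k => fderiv ℝ g w (turn w k)
  have hT : ∀ r, T r = ∑ k, r k • fderiv ℝ g w (turn w k) := fun r => rfl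
  suffices h : tangentSpace (g '' torus R) (g w) = LinearMap.range T by
    rw [h, LinearMap.mem_range]
    exact ⟨fun ⟨r, hr⟩ => ⟨r, by rw [← hr, hT]⟩, fun ⟨r, hr⟩ => ⟨r, by rw [hr, hT]⟩⟩
  refine le_antisymm (Submodule.span_le.2 ?_) ?_
  · rintro v ⟨γ, hγ0, hγ, hγd⟩
    have hgw : g w ∈ g.target := g.map_source (hRg hw)
    have hβ : HasDerivAt (fun t => g.symm (γ t)) (fderiv ℝ g.symm (g w) v) 0 := by
      have h1 := hg.hasFDerivAt_symm hgw
      rw [← hγ0] at h1 ⊢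
      exact h1.comp_hasDerivAt 0 hγd
    have hβt : ∀ t, g.symm (γ t) ∈ torus R := by
      intro t
      obtain ⟨y, hy, hyt⟩ := hγ t
      rwa [← hyt, g.left_inv (hRg hy)]
    have hβ0 : g.symm (γ 0) = w := by rw [hγ0, g.left_inv (hRg hw)]
    obtain ⟨d, hd⟩ : ∃ d, d = fderiv ℝ g.symm (g w) v := ⟨_, rfl⟩
    rw [← hd] at hβ
    have hv : fderiv ℝ g w d = v := by
      have := hg.fderiv_fderiv_symm hgw v
      rwa [g.left_inv (hRg hw), ← hd] at this
    -- the velocity is tangent to the circles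
    have htan : ∀ j, w.1 j * d.1 j + w.2 j * d.2 j = 0 := by
      intro j
      have e1 : HasDerivAt (fun t => (g.symm (γ t)).1 j) (d.1 j) 0 :=
        (hasDerivAt_pi.1 (hasFDerivAt_fst.comp_hasDerivAt 0 hβ)) j
      have e2 : HasDerivAt (fun t => (g.symm (γ t)).2 j) (d.2 j) 0 :=
        (hasDerivAt_pi.1 (hasFDerivAt_snd.comp_hasDerivAt 0 hβ)) j
      have e3 := (e1.pow 2).add (e2.pow 2)
      have e4 : (fun t => (g.symm (γ t)).1 j) ^ 2 + (fun t => (g.symm (γ t)).2 j) ^ 2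
          = fun _ => R j ^ 2 := by
        ext1 t; exact hβt t j
      rw [e4] at e3
      have e5 := e3.unique (hasDerivAt_const 0 (R j ^ 2))
      simp only [hβ0] at e5
      norm_num at e5
      linarith
    refine ⟨fun j => (d.1 j * w.2 j - d.2 j * w.1 j) / R j ^ 2, ?_⟩
    rw [hT, hsum, ← hv]
    congr 1
    rw [sum_smul_turn]
    ext j
    · have := hR j
      have h1 := hw j
      have h2 := htan j
      simp only
      rw [div_mul_eq_mul_div, div_eq_iff (by positivity), ← h1]
      linear_combination (-w.1 j) * h2
    · have := hR j
      have h1 := hw j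
      have h2 := htan j
      simp only
      rw [div_mul_eq_mul_div, ← neg_div, div_eq_iff (by positivity), ← h1]
      linear_combination (-w.2 j) * h2
  · rintro _ ⟨r, rfl⟩
    refine Submodule.subset_span ?_
    let β : ℝ → Phase n := fun t =>
      (fun j => w.1 j * Real.cos (r j * t) + w.2 j * Real.sin (r j * t),
        fun j => w.2 j * Real.cos (r j * t) - w.1 j * Real.sin (r j * t))
    have hβ0 : β 0 = w := by ext j <;> simp [β]
    have hβt : ∀ t, β t ∈ torus R := by
      intro t j
      have := Real.sin_sq_add_cos_sq (r j * t)
      rw [← hw j]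
      simp only [β]
      linear_combination (w.1 j ^ 2 + w.2 j ^ 2) * this
    have hβd : HasDerivAt β (∑ k, r k • turn w k) 0 := by
      rw [sum_smul_turn]
      have hc : ∀ j, HasDerivAt (fun t => Real.cos (r j * t)) 0 0 := fun j => by
        simpa using ((hasDerivAt_id (0 : ℝ)).const_mul (r j)).cos
      have hs : ∀ j, HasDerivAt (fun t => Real.sin (r j * t)) (r j) 0 := fun j => by
        simpa using ((hasDerivAt_id (0 : ℝ)).const_mul (r j)).sin
      refine HasDerivAt.prodMk (hasDerivAt_pi.2 fun j => ?_) (hasDerivAt_pi.2 fun j => ?_)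
      · exact (((hc j).const_mul (w.1 j)).add ((hs j).const_mul (w.2 j))).congr_deriv (by ring)
      · exact (((hc j).const_mul (w.2 j)).sub ((hs j).const_mul (w.1 j))).congr_deriv (by ring)
    refine ⟨fun t => g (β t), congrArg g hβ0, fun t => ⟨β t, hβt t, rfl⟩, ?_⟩
    rw [hT, hsum]
    have h1 := hg.hasFDerivAt (hRg hw)
    rw [← hβ0] at h1
    have h2 := h1.comp_hasDerivAt 0 hβd
    rwa [hβ0] at h2

/-! ### The action integral -/

/-- The bilinear form that represents the Liouville form: `p dx` is `liouvilleForm n z dz`. -/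
noncomputable def liouvilleForm (n : ℕ) : Phase n →L[ℝ] Phase n →L[ℝ] ℝ :=
  ∑ j, (ContinuousLinearMap.mul ℝ ℝ).bilinearComp
    ((ContinuousLinearMap.proj j).comp (ContinuousLinearMap.snd ℝ (Fin n → ℝ) (Fin n → ℝ)))
    ((ContinuousLinearMap.proj j).comp (ContinuousLinearMap.fst ℝ (Fin n → ℝ) (Fin n → ℝ)))

lemma liouvilleForm_apply (a b : Phase n) : liouvilleForm n a b = ∑ j, a.2 j * b.1 j := by
  simp [liouvilleForm, sum_apply]

lemma liouvilleForm_sub_swap (a b : Phase n) :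
    liouvilleForm n a b - liouvilleForm n b a = sigma a b := by
  simp only [liouvilleForm_apply, sigma, ← Finset.sum_sub_distrib]

/-- A symplectic map changes `p dx` by an exact form on convex sets, hence it does not change the
action integrals of loops there. -/
lemma liouvilleIntegral_comp {g : OpenPartialHomeomorph (Phase n) (Phase n)}
    (hg : IsSymplectomorphism g) {D : Set (Phase n)} (hD : Convex ℝ D) (hDg : D ⊆ g.source)
    {γ : ℝ → Phase n} (hγ : IsLoopOn D γ) :
    liouvilleIntegral (fun t => g (γ t)) = liouvilleIntegral γ := by
  let b : (Phase n × Phase n) →L[ℝ] (Phase n × Phase n) →L[ℝ] ℝ :=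
    (liouvilleForm n).bilinearComp (ContinuousLinearMap.fst ℝ _ _) (ContinuousLinearMap.fst ℝ _ _)
      - (liouvilleForm n).bilinearComp (ContinuousLinearMap.snd ℝ _ _)
        (ContinuousLinearMap.snd ℝ _ _)
  have hb : ∀ a c, b a c = liouvilleForm n a.1 c.1 - liouvilleForm n a.2 c.2 := fun a c => rfl
  have hder : ∀ z ∈ D, HasFDerivAt (fun z => (g z, z))
      ((fderiv ℝ g z).prod (ContinuousLinearMap.id ℝ _)) z := fun z hz =>
    (hg.hasFDerivAt (hDg hz)).prodMk (hasFDerivAt_id z)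
  obtain ⟨F, hF⟩ := exists_primitive hD b (p := fun z => (g z, z)) (q := fun z => (g z, z))
    (fun z hz => (hg.contDiffAt (hDg hz)).prodMk contDiffAt_id)
    (fun z hz => (hg.contDiffAt (hDg hz)).prodMk contDiffAt_id) (by
      intro z hz h k
      rw [(hder z hz).fderiv, hb, hb]
      have e1 := liouvilleForm_sub_swap (fderiv ℝ g z h) (fderiv ℝ g z k)
      have e2 := liouvilleForm_sub_swap h k
      rw [hg.map_sigma z (hDg hz)] at e1
      change liouvilleForm n (fderiv ℝ g z h) (fderiv ℝ g z k) - liouvilleForm n h k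
        = liouvilleForm n (fderiv ℝ g z k) (fderiv ℝ g z h) - liouvilleForm n k h
      linarith)
  have hγd : ∀ t, HasDerivAt γ (deriv γ t) t := fun t =>
    ((hγ.contDiff.differentiable (by simp)) t).hasDerivAt
  have hgγ : ContDiff ℝ ∞ (fun t => g (γ t)) := contDiff_iff_contDiffAt.2 fun t =>
    (hg.contDiffAt (hDg (hγ.mem t))).comp t hγ.contDiff.contDiffAt
  have hgγd : ∀ t, deriv (fun t => g (γ t)) t = fderiv ℝ g (γ t) (deriv γ t) := fun t =>
    ((hg.hasFDerivAt (hDg (hγ.mem t))).comp_hasDerivAt t (hγd t)).deriv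
  have hFd : ∀ t, HasDerivAt (fun t => F (γ t))
      (liouvilleForm n (g (γ t)) (deriv (fun t => g (γ t)) t)
        - liouvilleForm n (γ t) (deriv γ t)) t := by
    intro t
    have h1 := (hF _ (hγ.mem t)).comp_hasDerivAt t (hγd t) (Filter.Eventually.of_forall hγ.mem)
    rw [(hder _ (hγ.mem t)).fderiv] at h1
    rw [hgγd]
    exact h1
  have hcont : ∀ β : ℝ → Phase n, ContDiff ℝ ∞ β →
      Continuous fun t => liouvilleForm n (β t) (deriv β t) := fun β hβ =>
    ((liouvilleForm n).continuous.comp hβ.continuous).clm_apply (hβ.continuous_deriv (by simp))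
  have hint := intervalIntegral.integral_eq_sub_of_hasDerivAt (a := 0) (b := 1)
    (fun t _ => hFd t) (((hcont _ hgγ).sub (hcont _ hγ.contDiff)).intervalIntegrable _ _)
  have h01 : γ 1 = γ 0 := by simpa using hγ.periodic 0
  rw [intervalIntegral.integral_sub ((hcont _ hgγ).intervalIntegrable _ _)
    ((hcont _ hγ.contDiff).intervalIntegrable _ _), h01, sub_self, sub_eq_zero] at hint
  simpa only [liouvilleIntegral, liouvilleForm_apply] using hint

lemma torusCycle_eq (R : Fin n → ℝ) (j : Fin n) (t : ℝ) :
    torusCycle R j t = (Function.update R j 0, 0)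
      + (Real.cos (2 * Real.pi * t) • ((Pi.single j (R j), 0) : Phase n)
        + Real.sin (2 * Real.pi * t) • ((0, Pi.single j (-R j)) : Phase n)) := by
  ext k <;> by_cases h : k = j
  · subst h; simp [torusCycle, mul_comm]
  · simp [torusCycle, h]
  · subst h; simp [torusCycle, mul_comm]
  · simp [torusCycle, h]

lemma hasDerivAt_torusCycle (R : Fin n → ℝ) (j : Fin n) (t : ℝ) :
    HasDerivAt (torusCycle R j)
      ((-Real.sin (2 * Real.pi * t) * (2 * Real.pi)) • ((Pi.single j (R j), 0) : Phase n)
        + (Real.cos (2 * Real.pi * t) * (2 * Real.pi)) • ((0, Pi.single j (-R j)) : Phase n)) t := by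
  rw [funext (torusCycle_eq R j)]
  have h : HasDerivAt (fun t : ℝ => 2 * Real.pi * t) (2 * Real.pi) t := by
    simpa using (hasDerivAt_id t).const_mul (2 * Real.pi)
  exact ((h.cos.smul_const _).add (h.sin.smul_const _)).const_add _

lemma isLoopOn_torusCycle (R : Fin n → ℝ) (j : Fin n) : IsLoopOn (torus R) (torusCycle R j) where
  contDiff := by
    rw [funext (torusCycle_eq R j)]
    have h : ContDiff ℝ ∞ (fun t : ℝ => 2 * Real.pi * t) := contDiff_const.mul contDiff_id
    exact contDiff_const.add (((Real.contDiff_cos.comp h).smul contDiff_const).add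
      ((Real.contDiff_sin.comp h).smul contDiff_const))
  periodic := fun t => by
    have : 2 * Real.pi * (t + 1) = 2 * Real.pi * t + 2 * Real.pi := by ring
    simp only [torusCycle, this, Real.cos_add_two_pi, Real.sin_add_two_pi]
  mem := fun t k => by
    by_cases h : k = j
    · subst h
      have := Real.sin_sq_add_cos_sq (2 * Real.pi * t)
      simp only [torusCycle, Function.update_self, Pi.single_eq_same]
      linear_combination R k ^ 2 * this
    · simp [torusCycle, h]

lemma liouvilleIntegral_torusCycle (R : Fin n → ℝ) (j : Fin n) :
    liouvilleIntegral (torusCycle R j) = Real.pi * R j ^ 2 := by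
  have h1 : ∀ t, ∑ k, (torusCycle R j t).2 k * (deriv (torusCycle R j) t).1 k
      = R j ^ 2 * (2 * Real.pi) * Real.sin (2 * Real.pi * t) ^ 2 := by
    intro t
    rw [(hasDerivAt_torusCycle R j t).deriv, Finset.sum_eq_single j]
    · simp [torusCycle]; ring
    · intro k _ hk; simp [torusCycle, hk]
    · simp
  have h2 := intervalIntegral.mul_integral_comp_mul_left (a := (0 : ℝ)) (b := 1)
    (f := fun x => Real.sin x ^ 2) (2 * Real.pi)
  simp only [liouvilleIntegral, h1, intervalIntegral.integral_const_mul]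
  rw [mul_assoc, h2, integral_sin_sq]
  simp
  ring

/-! ### The Maslov indices of the basic cycles -/

lemma sum_smul_map_turn_eq_zero {A : Phase n →L[ℝ] Phase n}
    (hA : ∀ a b, sigma (A a) (A b) = sigma a b) {R : Fin n → ℝ} (hR : ∀ j, 0 < R j)
    {w : Phase n} (hw : w ∈ torus R) (r : Fin n → ℝ) (h : ∑ k, r k • A (turn w k) = 0) : r = 0 := by
  refine turn_independent hR hw (injective_of_map_sigma hA ?_)
  rw [map_zero, ← h]
  simp only [map_sum, map_smul]

lemma det_frameMatrix_ne_zero {b : Fin n → Phase n} (hb : ∀ k l, sigma (b k) (b l) = 0)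
    (hlin : ∀ r : Fin n → ℝ, ∑ k, r k • b k = 0 → r = 0) : (frameMatrix b).det ≠ 0 :=
  (det_souriauMatrix (l := Submodule.span ℝ (Set.range b)) (fun z => by
    rw [Submodule.mem_span_range_iff_exists_fun]
    exact exists_congr fun _ => eq_comm) hb hlin).1

lemma contDiff_toComplex (i : Fin n) : ContDiff ℝ ∞ fun z : Phase n => toComplex z i := by
  have e1 : ContDiff ℝ ∞ (fun x : ℝ => (x : ℂ)) := Complex.ofRealCLM.contDiff
  have e2 : ContDiff ℝ ∞ fun z : Phase n => z.1 i := (contDiff_apply ℝ ℝ i).comp contDiff_fst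
  have e3 : ContDiff ℝ ∞ fun z : Phase n => z.2 i := (contDiff_apply ℝ ℝ i).comp contDiff_snd
  exact (e1.comp e3).add (contDiff_const.mul (e1.comp e2))

lemma contDiffAt_det_frameMatrix {E : Type*} [NormedAddCommGroup E] [NormedSpace ℝ E]
    {b : E → Fin n → Phase n} {z : E} (hb : ∀ k, ContDiffAt ℝ ∞ (fun z => b z k) z) :
    ContDiffAt ℝ ∞ (fun z => (frameMatrix (b z)).det) z := by
  simp only [Matrix.det_apply']
  refine ContDiffAt.sum fun s _ => contDiffAt_const.mul (contDiffAt_prod fun i _ => ?_)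
  exact (contDiff_toComplex _).contDiffAt.comp z (hb _)

lemma contDiff_turn (k : Fin n) : ContDiff ℝ ∞ fun w : Phase n => turn w k := by
  have e2 : ContDiff ℝ ∞ fun z : Phase n => z.1 k := (contDiff_apply ℝ ℝ k).comp contDiff_fst
  have e3 : ContDiff ℝ ∞ fun z : Phase n => z.2 k := (contDiff_apply ℝ ℝ k).comp contDiff_snd
  have e1 : ∀ φ : Phase n → ℝ, ContDiff ℝ ∞ φ →
      ContDiff ℝ ∞ fun w => (Pi.single k (φ w) : Fin n → ℝ) := fun φ hφ => by
    refine contDiff_pi.2 fun i => ?_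
    by_cases h : i = k
    · subst h; simpa using hφ
    · simpa [h] using contDiff_const
  exact (e1 _ e3).prodMk (e1 _ e2.neg)

lemma turn_torusCycle (R : Fin n → ℝ) (j : Fin n) (t : ℝ) (k : Fin n) :
    turn (torusCycle R j t) k
      = if k = j then Real.cos (2 * Real.pi * t) • ((0, Pi.single j (-R j)) : Phase n)
          + Real.sin (2 * Real.pi * t) • ((Pi.single j (-R j), 0) : Phase n)
        else ((0, Pi.single k (-R k)) : Phase n) := by
  by_cases h : k = j
  · subst h
    rw [if_pos rfl]
    ext i <;> by_cases hi : i = k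
    · subst hi; simp [turn, torusCycle, mul_comm]
    · simp [turn, hi]
    · subst hi; simp [turn, torusCycle, mul_comm]
    · simp [turn, hi]
  · rw [if_neg h]
    ext i <;> by_cases hi : i = k
    · subst hi; simp [turn, torusCycle, h]
    · simp [turn, hi]
    · subst hi; simp [turn, torusCycle, h]
    · simp [turn, hi]

/-- For a linear symplectic map `A`, the frame of the tangent spaces along the `j`-th cycle has only
one column that moves, and its determinant describes an ellipse around zero. -/
lemma integral_det_linear {A : Phase n →L[ℝ] Phase n}
    (hA : ∀ a b, sigma (A a) (A b) = sigma a b) {R : Fin n → ℝ} (hR : ∀ j, 0 < R j) (j : Fin n) :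
    ∫ t in (0 : ℝ)..1,
      deriv (fun t => (frameMatrix fun k => A (turn (torusCycle R j t) k)).det) t /
        (frameMatrix fun k => A (turn (torusCycle R j t) k)).det = 2 * Real.pi * Complex.I := by
  let b : Fin n → Phase n := fun k => A (0, Pi.single k (-R k))
  let y : Phase n := A (Pi.single j (-R j), 0)
  have hb0 : b = fun k => A (turn (torusCycle R j 0) k) := by
    funext k
    rw [turn_torusCycle]
    by_cases h : k = j
    · subst h; simp [b]
    · simp [b, h]
  have hiso : ∀ k l, sigma (b k) (b l) = 0 := fun k l => by rw [hb0, hA, sigma_turn]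
  have hlin : ∀ r : Fin n → ℝ, ∑ k, r k • b k = 0 → r = 0 := fun r hr => by
    rw [hb0] at hr
    exact sum_smul_map_turn_eq_zero hA hR ((isLoopOn_torusCycle R j).mem 0) r hr
  have hcol : ∀ t, frameMatrix (fun k => A (turn (torusCycle R j t) k))
      = (frameMatrix b).updateCol j ((Real.cos (2 * Real.pi * t) : ℂ) • toComplex (b j)
        + (Real.sin (2 * Real.pi * t) : ℂ) • toComplex y) := by
    intro t
    ext i k
    simp only [frameMatrix, Matrix.of_apply, turn_torusCycle]
    by_cases h : k = j
    · subst h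
      rw [Matrix.updateCol_self, if_pos rfl, map_add, map_smul, map_smul]
      simp only [toComplex, b, y, Prod.fst_add, Prod.snd_add, Prod.smul_fst, Prod.smul_snd,
        Pi.add_apply, Pi.smul_apply, smul_eq_mul, Complex.ofReal_add, Complex.ofReal_mul]
      ring
    · rw [Matrix.updateCol_ne h, if_neg h]
      rfl
  have hself : (frameMatrix b).updateCol j (toComplex (b j)) = frameMatrix b := by
    ext i k
    by_cases h : k = j
    · subst h; rw [Matrix.updateCol_self]; rfl
    · rw [Matrix.updateCol_ne h]
  have hdet : ∀ t, (frameMatrix (fun k => A (turn (torusCycle R j t) k))).det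
      = (Real.cos (2 * Real.pi * t) : ℂ) * (frameMatrix b).det
        + (Real.sin (2 * Real.pi * t) : ℂ) * ((frameMatrix b).updateCol j (toComplex y)).det := by
    intro t
    rw [hcol, Matrix.det_updateCol_add, Matrix.det_updateCol_smul, Matrix.det_updateCol_smul, hself]
  simp only [hdet]
  refine integral_deriv_div_ellipse (im_det_updateCol_div_pos hiso hlin
    (det_frameMatrix_ne_zero hiso hlin) ?_ fun k hk => ?_)
  · have : sigma (b j) y = R j * R j := by
      simp only [b, y]
      rw [hA]
      simp [sigma, Pi.single_apply]
    rw [this]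
    exact mul_pos (hR j) (hR j)
  · simp only [b, y]
    rw [hA]
    simp [sigma, Pi.single_apply, hk.symm]

/-- Contracting the torus to the centre of the solid torus, where the derivative of `g` is a fixed
linear map, shows that the basic cycles of the image of the torus have Maslov index `2`. -/
theorem maslovIndex_cycle {g : OpenPartialHomeomorph (Phase n) (Phase n)}
    (hg : IsSymplectomorphism g) {R : Fin n → ℝ} (hR : ∀ j, 0 < R j)
    (hRg : solidTorus R ⊆ g.source) (j : Fin n) :
    maslovIndex (g '' torus R) (fun t => g (torusCycle R j t)) = 2 := by
  have hloop := isLoopOn_torusCycle R j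
  let b : ℝ × ℝ → Fin n → Phase n := fun z k =>
    fderiv ℝ g (z.1 • torusCycle R j z.2) (turn (torusCycle R j z.2) k)
  let Δ : ℝ × ℝ → ℂ := fun z => (frameMatrix (b z)).det
  have hmem : ∀ r ∈ Set.Icc (0 : ℝ) 1, ∀ t, r • torusCycle R j t ∈ g.source := fun r hr t =>
    hRg (smul_mem_solidTorus (torus_subset_solidTorus R (hloop.mem t)) hr)
  have hiso : ∀ r ∈ Set.Icc (0 : ℝ) 1, ∀ t, ∀ k l, sigma (b (r, t) k) (b (r, t) l) = 0 :=
    fun r hr t k l => by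
      simp only [b]
      rw [hg.map_sigma _ (hmem r hr t), sigma_turn]
  have hlin : ∀ r ∈ Set.Icc (0 : ℝ) 1, ∀ t, ∀ x : Fin n → ℝ, ∑ k, x k • b (r, t) k = 0 → x = 0 :=
    fun r hr t => sum_smul_map_turn_eq_zero (hg.map_sigma _ (hmem r hr t)) hR (hloop.mem t)
  have hne : ∀ r ∈ Set.Icc (0 : ℝ) 1, ∀ t, Δ (r, t) ≠ 0 := fun r hr t =>
    det_frameMatrix_ne_zero (hiso r hr t) (hlin r hr t)
  have hsm : ∀ r ∈ Set.Icc (0 : ℝ) 1, ∀ t, ContDiffAt ℝ ∞ Δ (r, t) := by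
    intro r hr t
    refine contDiffAt_det_frameMatrix fun k => ?_
    have h1 : ContDiffAt ℝ ∞ (fderiv ℝ g) (r • torusCycle R j t) :=
      (hg.contDiffAt (hmem r hr t)).fderiv_right (by norm_cast)
    have h2 : ContDiff ℝ ∞ fun z : ℝ × ℝ => torusCycle R j z.2 :=
      hloop.contDiff.comp contDiff_snd
    exact (h1.comp (r, t) (contDiff_fst.smul h2).contDiffAt).clm_apply
      ((contDiff_turn k).comp h2).contDiffAt
  have h01 := integral_deriv_div_eq hsm hne fun r t => by simp only [Δ, b, hloop.periodic t]
  have h0 : ∫ t in (0 : ℝ)..1, deriv (fun t => Δ (0, t)) t / Δ (0, t)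
      = 2 * Real.pi * Complex.I := by
    have := integral_det_linear (A := fderiv ℝ g 0)
      (hg.map_sigma 0 (by simpa using hmem 0 (by simp) 0)) hR j
    simpa only [Δ, b, zero_smul] using this
  have h1mem : (1 : ℝ) ∈ Set.Icc (0 : ℝ) 1 := by simp
  have hdet : ∀ t, (souriauMatrix (tangentSpace (g '' torus R) (g (torusCycle R j t)))).det
      = Δ (1, t) / star (Δ (1, t)) := by
    intro t
    refine (det_souriauMatrix (b := b (1, t)) (fun z => ?_) (hiso 1 h1mem t) (hlin 1 h1mem t)).2
    rw [mem_tangentSpace_image_torus hg hR ((torus_subset_solidTorus R).trans hRg) (hloop.mem t)]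
    simp only [b, one_smul]
  have hcd : ContDiff ℝ ∞ fun t => Δ (1, t) := contDiff_iff_contDiffAt.2 fun t =>
    (hsm 1 h1mem t).comp t (contDiff_const.prodMk contDiff_id).contDiffAt
  have hder : ∀ t, HasDerivAt (fun t => Δ (1, t)) (deriv (fun t => Δ (1, t)) t) t := fun t =>
    ((hcd.differentiable (by simp)) t).hasDerivAt
  obtain ⟨h, hh⟩ : ∃ h : ℝ → ℂ, h = fun t => deriv (fun t => Δ (1, t)) t / Δ (1, t) := ⟨_, rfl⟩
  have hlog : ∀ t, deriv (fun t => Δ (1, t) / star (Δ (1, t))) t / (Δ (1, t) / star (Δ (1, t)))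
      = h t - star (h t) := by
    intro t
    have hn := hne 1 h1mem t
    have hn' : star (Δ (1, t)) ≠ 0 := star_ne_zero.2 hn
    have e1 : HasDerivAt (fun t => Δ (1, t) / star (Δ (1, t))) _ t :=
      (hder t).div (hder t).star hn'
    rw [e1.deriv, hh]
    simp only [star_div₀]
    field_simp
  have hhc : Continuous h := by
    rw [hh]
    exact (hcd.continuous_deriv (by simp)).div hcd.continuous (hne 1 h1mem)
  have hint : ∫ t in (0 : ℝ)..1, h t = 2 * Real.pi * Complex.I := by
    rw [hh, ← h01, h0]
  have hstar : ∫ t in (0 : ℝ)..1, star (h t) = -(2 * Real.pi * Complex.I) := by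
    have : ∫ t in (0 : ℝ)..1, star (h t) = star (∫ t in (0 : ℝ)..1, h t) := by
      rw [intervalIntegral.integral_of_le zero_le_one, intervalIntegral.integral_of_le zero_le_one]
      exact integral_conj
    rw [this, hint]
    simp
  simp only [maslovIndex, hdet, hlog]
  rw [intervalIntegral.integral_sub (hhc.intervalIntegrable _ _)
    (hhc.star.intervalIntegrable _ _), hint, hstar]
  have := Real.pi_ne_zero
  field_simp
  norm_num

/-! ### Actions and energies -/

lemma convex_solidTorus (R : Fin n → ℝ) : Convex ℝ (solidTorus R) := by
  intro z hz w hw a b ha hb hab j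
  obtain rfl : b = 1 - a := by linarith
  have h1 := mul_le_mul_of_nonneg_left (hz j) ha
  have h2 := mul_le_mul_of_nonneg_left (hw j) hb
  have h3 := mul_nonneg (mul_nonneg ha hb)
    (add_nonneg (sq_nonneg (z.1 j - w.1 j)) (sq_nonneg (z.2 j - w.2 j)))
  simp only [Prod.fst_add, Prod.snd_add, Prod.smul_fst, Prod.smul_snd, Pi.add_apply, Pi.smul_apply,
    smul_eq_mul]
  linarith

lemma isCompact_solidTorus (R : Fin n → ℝ) : IsCompact (solidTorus R) := by
  refine Metric.isCompact_of_isClosed_isBounded ?_ ?_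
  · have : solidTorus R = ⋂ j, {z : Phase n | z.1 j ^ 2 + z.2 j ^ 2 ≤ R j ^ 2} := by
      ext z; simp [solidTorus]
    rw [this]
    exact isClosed_iInter fun j => isClosed_le (by fun_prop) continuous_const
  · refine (Metric.isBounded_closedBall (x := (0 : Phase n)) (r := ∑ j, |R j|)).subset fun z hz => ?_
    have hle : ∀ j, |R j| ≤ ∑ j, |R j| := fun j =>
      Finset.single_le_sum (f := fun j => |R j|) (fun _ _ => abs_nonneg _) (Finset.mem_univ j)
    have h0 : 0 ≤ ∑ j, |R j| := Finset.sum_nonneg fun _ _ => abs_nonneg _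
    rw [mem_closedBall_zero_iff, Prod.norm_def]
    refine max_le ((pi_norm_le_iff_of_nonneg h0).2 fun j => ?_)
      ((pi_norm_le_iff_of_nonneg h0).2 fun j => ?_)
    · exact (sq_le_sq.1 (by nlinarith [hz j, sq_nonneg (z.2 j)])).trans (hle j)
    · exact (sq_le_sq.1 (by nlinarith [hz j, sq_nonneg (z.1 j)])).trans (hle j)

/-- A function with positive frequencies on a box is monotone along the edge path from the lowest
to the highest vertex. A positive value of `frequency` excludes the default value `0` of
derivatives that do not exist. -/
lemma le_of_frequency_pos {K : (Fin n → ℝ) → ℝ} {S : Set (Fin n → ℝ)}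
    (hK : ∀ I ∈ S, ∀ j, 0 < frequency K j I) {a b : Fin n → ℝ} (hab : a ≤ b)
    (hS : Set.Icc a b ⊆ S) : K a ≤ K b := by
  have key : ∀ s : Finset (Fin n), K a ≤ K (s.piecewise b a) := by
    intro s
    induction s using Finset.induction_on with
    | empty => simp
    | insert j s hj ih =>
      refine ih.trans ?_
      obtain ⟨u, hu⟩ : ∃ u, u = s.piecewise b a := ⟨_, rfl⟩
      have huj : u j = a j := by rw [hu, Finset.piecewise_eq_of_notMem _ _ _ hj]
      have hua : a ≤ u := hu ▸ Finset.le_piecewise_of_le_of_le _ hab le_rfl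
      have hub : u ≤ b := hu ▸ Finset.piecewise_le_of_le_of_le _ le_rfl hab
      have hpos : ∀ τ ∈ Set.Icc 0 (b j - a j),
          0 < deriv (fun τ => K (u + τ • Pi.single j 1)) τ := by
        intro τ hτ
        have hm : u + τ • Pi.single j 1 ∈ Set.Icc a b := by
          refine ⟨fun i => ?_, fun i => ?_⟩
          · by_cases h : i = j
            · subst h; simp; linarith [hτ.1]
            · simpa [h] using hua i
          · by_cases h : i = j
            · subst h; simp; linarith [hτ.2]
            · simpa [h] using hub i
        have h1 := hK _ (hS hm) j
        have h2 := deriv_comp_add_const (fun τ => K (u + τ • Pi.single j 1)) τ 0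
        rw [zero_add] at h2
        rw [← h2]
        simp only [frequency, lineDeriv] at h1
        convert h1 using 3
        congr 1
        module
      have hmono : StrictMonoOn (fun τ => K (u + τ • Pi.single j 1)) (Set.Icc 0 (b j - a j)) :=
        strictMonoOn_of_deriv_pos (convex_Icc _ _)
          (fun τ hτ => (differentiableAt_of_deriv_ne_zero
            (hpos τ hτ).ne').continuousAt.continuousWithinAt)
          (fun τ hτ => hpos τ (interior_subset hτ))
      have hle : 0 ≤ b j - a j := sub_nonneg.2 (hab j)
      have h3 := hmono.monotoneOn (Set.left_mem_Icc.2 hle) (Set.right_mem_Icc.2 hle) hle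
      have h4 : u + (b j - a j) • Pi.single j 1 = (insert j s).piecewise b a := by
        rw [Finset.piecewise_insert, ← hu]
        funext i
        by_cases h : i = j
        · subst h; simp [huj]
        · simp [h]
      simp only [zero_smul, add_zero] at h3
      rw [h4] at h3
      rwa [← hu]
  simpa using key Finset.univ

lemma Icc_subset_actionDomain {f : OpenPartialHomeomorph (Phase n) (Phase n)} {R : Fin n → ℝ}
    (hD : solidTorus R ⊆ f.target) {a : ℝ} (ha : 0 < a) :
    Set.Icc (fun _ => a) (fun j => R j ^ 2 / 2) ⊆ actionDomain f := by
  intro I hI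
  have hpos : ∀ j, 0 < I j := fun j => ha.trans_le (hI.1 j)
  have hsq : ∀ j, √(2 * I j) ^ 2 = 2 * I j := fun j => Real.sq_sqrt (by linarith [hpos j])
  refine ⟨hpos, (fun j => √(2 * I j), 0), hD fun j => ?_, ?_⟩
  · have h := hI.2 j
    simp only at h
    simp only [hsq, Pi.zero_apply]
    linarith
  · funext j
    simp only [action, hsq, Pi.zero_apply]
    ring

lemma capacity_solidTorus_le {c : Set (Phase n) → ENNReal} (hc : IsSymplecticCapacity c)
    {R : Fin n → ℝ} (hR : ∀ j, 0 < R j) (j : Fin n) :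
    c (solidTorus R) ≤ ENNReal.ofReal (Real.pi * R j ^ 2) :=
  (hc.mono _ _ fun z (hz : z ∈ solidTorus R) => hz j).trans_eq (hc.cylinder j (R j) (hR j))

lemma le_capacity_solidTorus {c : Set (Phase n) → ENNReal} (hc : IsSymplecticCapacity c)
    {R : Fin n → ℝ} {r : ℝ} (hr : 0 < r) (h : ∀ j, r ^ 2 ≤ R j ^ 2) :
    ENNReal.ofReal (Real.pi * r ^ 2) ≤ c (solidTorus R) := by
  rw [← hc.ball r hr]
  refine hc.mono _ _ fun z hz j => le_trans ?_ (h j)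
  exact (Finset.single_le_sum (f := fun j => z.1 j ^ 2 + z.2 j ^ 2)
    (fun _ _ => by positivity) (Finset.mem_univ j)).trans hz

end EBK

theorem theorem2 {n : ℕ} {hbar : ℝ} (hbar_pos : 0 < hbar)
    -- the Hamiltonian, the action-angle map `f`, and `K = H ∘ f⁻¹` as a function of the actions
    (H : EBK.Phase n → ℝ) (hH : ContDiff ℝ ∞ H)
    (f : OpenPartialHomeomorph (EBK.Phase n) (EBK.Phase n)) (hf : EBK.IsSymplectomorphism f)
    (K : (Fin n → ℝ) → ℝ) (hK : ∀ z ∈ f.source, H z = K (EBK.action (f z)))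
    -- the Lagrangian manifold `V`, which `f` maps onto the torus of radii `R`
    (V : Set (EBK.Phase n)) (hVcompact : IsCompact V) (hVconnected : IsConnected V)
    (hVLagrangian : EBK.IsLagrangianManifold V)
    (R : Fin n → ℝ) (hR : ∀ j, 0 < R j)
    (hVsource : V ⊆ f.source) (hVtorus : f '' V = EBK.torus R)
    -- the solid torus has a preimage under `f`
    (hD : EBK.solidTorus R ⊆ f.target) :
    -- (1)
    (EBK.SatisfiesEBK hbar V →
      ∀ c : Set (EBK.Phase n) → ENNReal, EBK.IsSymplecticCapacity c →
        ENNReal.ofReal (1 / 2 * (2 * Real.pi * hbar)) ≤ c (f.symm '' EBK.solidTorus R)) ∧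
    -- (2)
    (∀ c : Set (EBK.Phase n) → ENNReal, EBK.IsSymplecticCapacity c →
      ENNReal.ofReal (1 / 2 * (2 * Real.pi * hbar)) ≤ c (f.symm '' EBK.solidTorus R) →
      (∀ I ∈ EBK.actionDomain f, ∀ j, 0 < EBK.frequency K j I) →
        ∀ z ∈ V, K (fun _ => 1 / 2 * hbar) ≤ H z) ∧
    -- the Maslov indices of the basic cycles, and the energy levels
    ∃ m : Fin n → ℤ,
      (∀ j, EBK.maslovIndex V (EBK.basicCycle f R j) = (m j : ℂ)) ∧
      (∀ j, 2 ≤ m j) ∧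
      ((∀ I ∈ EBK.actionDomain f, ∀ j, 0 < EBK.frequency K j I) →
        ∀ N : Fin n → ℕ,
          Set.Icc (fun _ => 1 / 2 * hbar) (EBK.ebkAction hbar m N) ⊆ EBK.actionDomain f →
          K (fun _ => 1 / 2 * hbar) ≤ EBK.ebkEnergy K hbar m N) := by
  have hV : V = f.symm '' EBK.torus R := by
    rw [← hVtorus, Set.image_image]
    exact (Set.image_id V).symm.trans (Set.image_congr fun z hz => (f.left_inv (hVsource hz)).symm)
  have hg := hf.symm
  have hTD := EBK.torus_subset_solidTorus R
  have hcycle : ∀ j, EBK.basicCycle f R j = fun t => f.symm (EBK.torusCycle R j t) := fun _ => rfl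
  have hmaslov : ∀ j, EBK.maslovIndex V (EBK.basicCycle f R j) = 2 := fun j => by
    rw [hV, hcycle]
    exact EBK.maslovIndex_cycle hg hR hD j
  have hcap : ∀ c : Set (EBK.Phase n) → ENNReal, EBK.IsSymplecticCapacity c →
      c (f.symm '' EBK.solidTorus R) = c (EBK.solidTorus R) := fun c hc =>
    hc.image_eq hg (EBK.isCompact_solidTorus R) (EBK.convex_solidTorus R)
      (fun j => by simp [sq_nonneg]) hD
  have hhalf : 1 / 2 * (2 * Real.pi * hbar) = Real.pi * hbar := by ring
  refine ⟨fun hEBK c hc => ?_, fun c hc hle hfreq z hz => ?_, fun _ => 2, fun j => ?_,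
    fun _ => le_rfl, fun hfreq N hN => ?_⟩
  · -- the EBK condition on the basic cycles makes `R j ^ 2` an odd multiple of `hbar`
    have hodd : ∀ j, hbar ≤ R j ^ 2 := by
      intro j
      have hloop := EBK.isLoopOn_torusCycle R j
      have hγ : EBK.IsLoopOn V (EBK.basicCycle f R j) :=
        ⟨contDiff_iff_contDiffAt.2 fun t =>
            (hg.contDiffAt (hD (hTD (hloop.mem t)))).comp t hloop.contDiff.contDiffAt,
          fun t => congrArg f.symm (hloop.periodic t),
          fun t => hV ▸ Set.mem_image_of_mem _ (hloop.mem t)⟩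
      obtain ⟨k, hk⟩ := hEBK _ hγ
      rw [hmaslov, hcycle, EBK.liouvilleIntegral_comp hg (EBK.convex_solidTorus R) hD
        ⟨hloop.contDiff, hloop.periodic, fun t => hTD (hloop.mem t)⟩,
        EBK.liouvilleIntegral_torusCycle] at hk
      have h1 : 1 / (2 * Real.pi * hbar) * (Real.pi * R j ^ 2) - 1 / 2 = (k : ℝ) := by
        have := congrArg Complex.re hk
        simp only [Complex.sub_re, Complex.ofReal_re, Complex.intCast_re] at this
        rw [← this]
        norm_num
      have h2 : R j ^ 2 = (2 * k + 1) * hbar := by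
        have := Real.pi_ne_zero
        have := hbar_pos.ne'
        rw [← h1]
        field_simp
        ring
      have h3 : 0 < (2 * k + 1 : ℝ) * hbar := h2 ▸ pow_pos (hR j) 2
      have h4 : 0 < (2 * k + 1 : ℝ) := pos_of_mul_pos_left h3 hbar_pos.le
      have h5 : 0 ≤ k := by
        have : 0 < 2 * k + 1 := by exact_mod_cast h4
        omega
      have h6 : (0 : ℝ) ≤ k := by exact_mod_cast h5
      rw [h2]
      nlinarith
    rw [hcap c hc, hhalf, ← Real.sq_sqrt hbar_pos.le]
    refine EBK.le_capacity_solidTorus hc (Real.sqrt_pos.2 hbar_pos) fun j => ?_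
    rw [Real.sq_sqrt hbar_pos.le]
    exact hodd j
  · have hR2 : ∀ j, hbar ≤ R j ^ 2 := by
      intro j
      rw [hcap c hc, hhalf] at hle
      have h1 := hle.trans (EBK.capacity_solidTorus_le hc hR j)
      rw [ENNReal.ofReal_le_ofReal_iff (by positivity)] at h1
      exact le_of_mul_le_mul_left h1 Real.pi_pos
    have hact : EBK.action (f z) = fun j => R j ^ 2 / 2 := by
      have hfz : f z ∈ EBK.torus R := hVtorus ▸ Set.mem_image_of_mem f hz
      funext j
      simp only [EBK.action, hfz j]
    rw [hK z (hVsource hz), hact]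
    exact EBK.le_of_frequency_pos hfreq (fun j => by simp only; linarith [hR2 j])
      (EBK.Icc_subset_actionDomain hD (by positivity))
  · rw [hmaslov]
    norm_num
  · refine EBK.le_of_frequency_pos hfreq (fun j => ?_) hN
    have : (0 : ℝ) ≤ N j := Nat.cast_nonneg _
    simp only [EBK.ebkAction]
    push_cast
    nlinarith
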